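/- Let $k$ be an uncountable algebraically closed field, let $X$ be an integral scheme of finite type over $k$, and let $\sigma: X \to X$ be a $k$-automorphism. In the following, "point" means closed point. For a point $x$ write $\mathcal{O}_x = \{\sigma^n(x) \mid n \in \mathbb{Z}\}$. A closed subset $Z \subseteq X$ is *$\sigma$-invariant* if $\sigma(Z) = Z$, and a $\sigma$-invariant closed subset $Z$ is *$\sigma$-irreducible* if it is not a union $Z_1 \cup Z_2$ of two closed $\sigma$-invariant subsets $Z_1, Z_2 \subsetneq Z$. For a $\sigma$-invariant closed subset $Z$, the pair $(Z, \sigma|_Z)$ *has good dense orbits* if the set of points $z \in Z$ such that $\mathcal{O}_z$ is Zariski dense in $Z$ is (Zariski) open in the set of points of $Z$. The pair $(X, \sigma)$ is *ordinary* if $(Z, \sigma|_Z)$ has good dense orbits for every $\sigma$-irreducible closed subset $Z \subseteq X$. An *algebraic group* is a reduced group scheme of finite type over $k$, and $\sim$ denotes linear equivalence of Cartier divisors. A Cartier divisor $D$ on $X$ is *big* if for some $m \geq 1$ the linear series $|mD|$ is nonempty and the closure of the image of the associated rational map $X \dashrightarrow \mathbb{P}^d$ has dimension $\dim X$. 1.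 If an algebraic group $G$ acts on $X$ and some $g \in G(k)$ acts by $\sigma$, then $(X, \sigma)$ is ordinary. 2. If $X$ is proper over $k$ and $D$ is an ample Cartier divisor on $X$ with $(\sigma^n)^* D \sim D$ for some $n \geq 1$, then $(X, \sigma)$ is ordinary. 3. If $X$ is proper over $k$ and $D$ is a big Cartier divisor on $X$ with $(\sigma^n)^* D \sim D$ for some $n \geq 1$, then $(X, \sigma)$ has good dense orbits. -/

import Mathlib

open CategoryTheory AlgebraicGeometry

universe u

namespace SchemeDynamics

section Orbits

variable {X : Scheme.{u}}

/-- The orbit `{σⁿ(x) | n ∈ ℤ}` of a point of `X`. -/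
def orbit (σ : Aut X) (x : X) : Set X :=
  Set.range fun n : ℤ => (σ ^ n).hom x

/-- A subset `Z` of `X` with `σ(Z) = Z`. -/
def IsInvariant (σ : Aut X) (Z : Set X) : Prop :=
  (fun x : X => σ.hom x) '' Z = Z

/-- A closed `σ`-invariant subset which is not the union of two proper closed
`σ`-invariant subsets. -/
def IsSigmaIrreducible (σ : Aut X) (Z : Set X) : Prop :=
  IsClosed Z ∧ IsInvariant σ Z ∧
    ¬ ∃ Z₁ Z₂ : Set X, (IsClosed Z₁ ∧ IsInvariant σ Z₁ ∧ Z₁ ⊂ Z) ∧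
      (IsClosed Z₂ ∧ IsInvariant σ Z₂ ∧ Z₂ ⊂ Z) ∧ Z = Z₁ ∪ Z₂

/-- `(Z, σ|_Z)` has good dense orbits, for a closed `σ`-invariant subset `Z` of `X`: the set of
closed points of `Z` whose `σ`-orbit is dense in `Z` is open in the set of closed points of `Z`. -/
def HasGoodDenseOrbitsOn (σ : Aut X) (Z : Set X) : Prop :=
  ∃ V : Set X, IsOpen V ∧
    {z | z ∈ Z ∩ closedPoints X ∧ closure (orbit σ z) = Z} = V ∩ (Z ∩ closedPoints X)

/-- `(X, σ)` has good dense orbits. -/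
def HasGoodDenseOrbits (σ : Aut X) : Prop :=
  HasGoodDenseOrbitsOn σ Set.univ

/-- `(X, σ)` is ordinary. -/
def IsOrdinary (σ : Aut X) : Prop :=
  ∀ Z : Set X, IsSigmaIrreducible σ Z → HasGoodDenseOrbitsOn σ Z

end Orbits

section CartierDivisors

variable (X : Scheme.{u}) [IsIntegral X]

/-- The image of `𝒪_{X,x}ˣ` in `K(X)ˣ`. -/
noncomputable def stalkUnits (x : X) : Subgroup (X.functionField)ˣ :=
  (Units.map (algebraMap (X.presheaf.stalk x) X.functionField).toMonoidHom).range

/-- The group `Γ(X, 𝒦ˣ/𝒪ˣ)`, written multiplicatively. As `X` is integral, `𝒦ˣ` is the constant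
sheaf `K(X)ˣ`, and a section of the sheafification `𝒦ˣ/𝒪ˣ` is a family of elements of the stalks
`K(X)ˣ/𝒪_{X,x}ˣ` which is locally induced by a single rational function. -/
noncomputable def cartierSubgroup :
    Subgroup (∀ x : X, (X.functionField)ˣ ⧸ stalkUnits X x) where
  carrier := {D | ∀ x : X, ∃ U : X.Opens, x ∈ U ∧ ∃ f : (X.functionField)ˣ,
    ∀ y ∈ U, D y = QuotientGroup.mk f}
  one_mem' x := ⟨⊤, trivial, 1, fun _ _ => rfl⟩
  mul_mem' {D E} hD hE x := by
    obtain ⟨U, hU, f, hf⟩ := hD x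
    obtain ⟨V, hV, g, hg⟩ := hE x
    refine ⟨U ⊓ V, ⟨hU, hV⟩, f * g, fun y hy => ?_⟩
    rw [Pi.mul_apply, hf y hy.1, hg y hy.2]
    rfl
  inv_mem' {D} hD x := by
    obtain ⟨U, hU, f, hf⟩ := hD x
    refine ⟨U, hU, f⁻¹, fun y hy => ?_⟩
    rw [Pi.inv_apply, hf y hy]
    rfl

/-- The additive group of Cartier divisors on an integral scheme. -/
abbrev CartierDivisor : Type u := Additive (cartierSubgroup X)

variable {X}

/-- The class in `K(X)ˣ/𝒪_{X,x}ˣ` of a local equation of `D` at `x`. -/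
noncomputable def CartierDivisor.localClass (D : CartierDivisor X) (x : X) :
    (X.functionField)ˣ ⧸ stalkUnits X x :=
  (Additive.toMul D).1 x

/-- The principal divisor of a nonzero rational function. -/
noncomputable def CartierDivisor.principal (f : (X.functionField)ˣ) : CartierDivisor X :=
  Additive.ofMul ⟨fun _ => QuotientGroup.mk f, fun _ => ⟨⊤, trivial, f, fun _ _ => rfl⟩⟩

/-- Linear equivalence of Cartier divisors. -/
def CartierDivisor.LinEquiv (D E : CartierDivisor X) : Prop :=
  ∃ f : (X.functionField)ˣ, D = E + CartierDivisor.principal f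

/-- The set `H⁰(X, 𝒪_X(D)) ⊆ K(X)` of all rational functions `f` such that `f u ∈ 𝒪_{X,x}` for
every local equation `u` of `D` at every point `x`. -/
def CartierDivisor.globalSections (D : CartierDivisor X) : Set X.functionField :=
  {f | ∀ (x : X) (v : (X.functionField)ˣ), D.localClass x = QuotientGroup.mk v →
    f * (v : X.functionField) ∈ (algebraMap (X.presheaf.stalk x) X.functionField).range}

/-- The locus `X_f` of points at which `f ∈ H⁰(X, 𝒪_X(D))` generates `𝒪_X(D)`. -/
def CartierDivisor.nonvanishingLocus (D : CartierDivisor X) (f : X.functionField) : Set X :=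
  {x | ∃ v : (X.functionField)ˣ, D.localClass x = QuotientGroup.mk v ∧
    ∃ a : (X.presheaf.stalk x)ˣ,
      f * (v : X.functionField) = algebraMap (X.presheaf.stalk x) X.functionField a}

/-- `D` is ample: `X` is quasi-compact and every point of `X` lies in an affine open subset of
the form `X_f` with `f ∈ H⁰(X, 𝒪_X(mD))`, `m ≥ 1`. -/
def CartierDivisor.IsAmple (D : CartierDivisor X) : Prop :=
  CompactSpace X ∧ ∀ x : X, ∃ m : ℕ, 1 ≤ m ∧ ∃ f ∈ (m • D).globalSections,
    ∃ U : X.Opens, x ∈ U ∧ IsAffineOpen U ∧ (U : Set X) = (m • D).nonvanishingLocus f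

/-- The inclusion `k → K(X)` for an integral `k`-scheme `p : X ⟶ Spec k`. -/
noncomputable def constants {k : Type u} [Field k] (p : X ⟶ Spec (.of k)) :
    k →+* X.functionField :=
  ((X.presheaf.germ ⊤ (genericPoint X) trivial).hom.comp p.appTop.hom).comp
    (Scheme.ΓSpecIso (.of k)).inv.hom

/-- `D` is big: for some `m ≥ 1` the linear series `|mD|` is nonempty and the closure of the image
of the associated rational map `X ⇢ ℙ^d`, whose function field is generated over `k` by the
quotients `f/g` of elements of `H⁰(X, 𝒪_X(mD))`, has the same dimension as `X`. Dimensions are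
expressed as transcendence degrees over `k` of function fields. -/
def CartierDivisor.IsBig {k : Type u} [Field k] (p : X ⟶ Spec (.of k))
    (D : CartierDivisor X) : Prop :=
  letI : Algebra k X.functionField := (constants p).toAlgebra
  ∃ m : ℕ, 1 ≤ m ∧ (∃ g ∈ (m • D).globalSections, g ≠ 0) ∧
    Algebra.trdeg k (IntermediateField.adjoin k
      {h : X.functionField | ∃ f ∈ (m • D).globalSections, ∃ g ∈ (m • D).globalSections,
        g ≠ 0 ∧ h = f / g}) = Algebra.trdeg k X.functionField

end CartierDivisors

section Pullback

variable {X Y : Scheme.{u}} [IsIntegral X] [IsIntegral Y]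

lemma map_genericPoint (f : X ⟶ Y) [IsDominant f] : f (genericPoint X) = genericPoint Y := by
  apply ((genericPoint_spec Y).eq _).symm
  have h := (genericPoint_spec X).image f.continuous
  rwa [Set.image_univ, f.denseRange.closure_range] at h

/-- The homomorphism `K(Y) → K(X)` induced by a dominant morphism `f : X ⟶ Y`. -/
noncomputable def functionFieldMap (f : X ⟶ Y) [IsDominant f] :
    Y.functionField →+* X.functionField :=
  (Y.presheaf.stalkSpecializes (specializes_of_eq (map_genericPoint f)) ≫
    f.stalkMap (genericPoint X)).hom

lemma functionFieldMap_algebraMap (f : X ⟶ Y) [IsDominant f] (x : X)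
    (a : Y.presheaf.stalk (f x)) :
    functionFieldMap f (algebraMap (Y.presheaf.stalk (f x)) Y.functionField a) =
      algebraMap (X.presheaf.stalk x) X.functionField (f.stalkMap x a) := by
  have h := Scheme.Hom.stalkSpecializes_stalkMap_apply f (genericPoint X) x
    ((genericPoint_spec X).specializes trivial) a
  simp only [functionFieldMap, RingHom.algebraMap_toAlgebra]
  refine Eq.trans ?_ h
  simp only [← CommRingCat.comp_apply, ← Category.assoc, TopCat.Presheaf.stalkSpecializes_comp]

lemma stalkUnits_le_comap (f : X ⟶ Y) [IsDominant f] (x : X) :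
    stalkUnits Y (f x) ≤
      (stalkUnits X x).comap (Units.map (functionFieldMap f).toMonoidHom) := by
  rintro _ ⟨a, rfl⟩
  refine ⟨Units.map (f.stalkMap x).hom.toMonoidHom a, Units.ext ?_⟩
  exact (functionFieldMap_algebraMap f x (a : Y.presheaf.stalk (f x))).symm

/-- The pullback `f^* D` of a Cartier divisor along a dominant morphism: local equations of `D`
are composed with `f`. -/
noncomputable def CartierDivisor.pullback (f : X ⟶ Y) [IsDominant f] (D : CartierDivisor Y) :
    CartierDivisor X :=
  Additive.ofMul ⟨fun x => QuotientGroup.map (stalkUnits Y (f x)) (stalkUnits X x)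
      (Units.map (functionFieldMap f).toMonoidHom) (stalkUnits_le_comap f x)
      (D.localClass (f x)), fun x => by
    obtain ⟨U, hU, g, hg⟩ := (Additive.toMul D).2 (f x)
    refine ⟨f ⁻¹ᵁ U, hU, Units.map (functionFieldMap f).toMonoidHom g, fun y hy => ?_⟩
    have h : D.localClass (f y) = QuotientGroup.mk g := hg (f y) hy
    change QuotientGroup.map _ _ _ (stalkUnits_le_comap f y) (D.localClass (f y)) = _
    rw [h]
    rfl⟩

instance (σ : Aut X) : IsDominant σ.hom :=
  haveI : IsIso σ.hom := Iso.isIso_hom (X := X) (Y := X) σ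
  inferInstance

end Pullback

section GroupActions

open MonoidalCategory MonoidalLeftAction
open scoped MonObj

/-- A group scheme over `k` is an algebraic group if it is reduced and of finite type. -/
def IsAlgebraicGroup {k : Type u} [Field k] (G : Over (Spec (.of k))) [GrpObj G] : Prop :=
  IsReduced G.left ∧ LocallyOfFiniteType G.hom ∧ QuasiCompact G.hom

/-- The endomorphism of a `k`-scheme `X` by which a `k`-point `g` of a group scheme `G` acting
on `X` acts. -/
noncomputable def actBy {k : Type u} [Field k] {G X : Over (Spec (.of k))} [GrpObj G]
    [ModObj G X] (g : 𝟙_ (Over (Spec (.of k))) ⟶ G) : X ⟶ X :=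
  (λₗ X).inv ≫ g ⊵ₗ X ≫ ModObj.smul

end GroupActions

end SchemeDynamics

/-!
In all three parts, a closed point `z` with dense orbit in `Z` is used to produce an open set of
such points; if there is none, the empty set will do.

*Group actions* (`isOrdinary_of_action`). Let `H` be the closure of `{gⁱ}` in `G`. The image of
`H` under the orbit map of `z` is constructible and dense in `Z`, so it contains `U ∩ Z ≠ ∅` for
an open set `U`. If the orbit of a closed point `w ∈ Z` meets `U`, then up to a power of `g` we
have `w = h z` with a rational point `h` of `H`; as `H` is stable under inversion, `z = h⁻¹ w`
lies in `H w`, hence in the closure of the orbit of `w`, which is therefore dense. So the set of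
closed points with dense orbit is cut out by `⋃ᵢ gⁱ U`.

*Divisors* (`hasGoodDenseOrbitsOn_of_linEquiv`). After replacing `σ` by an iterate and `Z` by an
irreducible component `W` (`exists_isOpen_dense_iff_of_components`), the relation `τ^* D = D + div
f` with `τ = σⁿ` makes `h ↦ (h ∘ τ) f ^ r` a linear automorphism `φ` of every `H⁰(X, rD)`,
compatible with products. Consider the eigensections: sections not vanishing on `W` which are
eigenvectors of `φ` modulo sections vanishing on `W`.

* The zeros of an eigensection form an invariant proper closed subset of `W`, so no eigensection
  vanishes at a point with dense orbit (`notMem_eigenZero_of_dense`).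
* If the orbit of `w` is not dense and `W` carries enough sections, then the sections vanishing on
  the orbit form a `φ`-invariant space, which is finite-dimensional, and an eigenvector in it is
  an eigensection vanishing at `w` (`exists_mem_eigenZero_of_not_dense`).
* Finitely many eigensections account for all zeros (`exists_finite_eigenZero`). Given a point
  with dense orbit, eigensections of the same degree and eigenvalue are proportional on `W`. On
  the other hand, eigensections whose characters (degree and eigenvalue) are independent are
  algebraically independent in `K(X)(T)`, so a maximal independent family is finite, and some
  positive power of any eigensection, times a monomial in this family, is proportional to a
  monomial in this family.

The finite-dimensionality of `H⁰(X, D)` for proper `X` is proved without cohomology. By the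
valuative criterion, every valuation ring of `K(X) / k` contains a local ring of `X`; hence for `h
∈ H⁰(X, D)` the element `h T` of `K(X)(T)` is integral over the algebra generated by the `m T`,
where `m` runs through a finite set containing the inverses of local equations of `D`. The
integral closure of this finitely generated domain is finite
(`finiteDimensional_of_forall_valuationSubring`).

For ample `D`, sections separate points from closed subsets
(`CartierDivisor.IsAmple.exists_section`). For big `D`, every proper closed subset of `X` lies in
the zero locus of a nonzero section (`CartierDivisor.IsBig.exists_section_of_isClosed`), which
suffices for `Z = X`.
-/

namespace SchemeDynamics

/-! ### Finiteness of integral closures -/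

section IntegralClosure

lemma isNoetherian_of_injective_of_finite_comp {A B C : Type*} [CommRing A] [IsNoetherianRing A]
    [CommRing B] [CommRing C] [Algebra A C] (g : C →+* B) (hg : Function.Injective g)
    (hfin : (g.comp (algebraMap A C)).Finite) : IsNoetherian A C := by
  let := (g.comp (algebraMap A C)).toAlgebra
  have : Module.Finite A B := hfin
  let g' : C →ₐ[A] B := { g with commutes' := fun _ => rfl }
  have : IsNoetherian A B := isNoetherian_of_isNoetherianRing_of_finite A B
  exact isNoetherian_of_injective g'.toLinearMap hg

/-- Frobenius is integral, and it is of finite type because it is bijective on `k`. -/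
lemma finite_iterateFrobenius_mvPolynomial (k σ : Type*) [Finite σ] [Field k] [PerfectField k]
    (p n : ℕ) [ExpChar k p] [ExpChar (MvPolynomial σ k) p] :
    (iterateFrobenius (MvPolynomial σ k) p n).Finite := by
  have : PerfectRing k p := PerfectField.toPerfectRing p
  refine RingHom.IsIntegral.to_finite (fun x => ?_) ?_
  · refine ⟨Polynomial.X ^ p ^ n - Polynomial.C x, Polynomial.monic_X_pow_sub_C _
      (expChar_pow_pos k p n).ne', by simp [iterateFrobenius_def]⟩
  · have h : (iterateFrobenius (MvPolynomial σ k) p n).comp MvPolynomial.C =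
        MvPolynomial.C.comp (iterateFrobenius k p n) := by
      ext1 x
      simp [iterateFrobenius_def]
    refine RingHom.FiniteType.of_comp_finiteType (f := MvPolynomial.C) ?_
    rw [h]
    refine RingHom.FiniteType.comp ?_ (RingHom.FiniteType.of_surjective _ ?_)
    · have : Algebra.FiniteType k (MvPolynomial σ k) := inferInstance
      exact (RingHom.finiteType_algebraMap (A := k) (B := MvPolynomial σ k)).mpr this
    · exact (iterateFrobeniusEquiv k p n).surjective

/-- The integral closure of a polynomial ring over a perfect field `k` in a finite extension `L` of
its fraction field `F` is Noetherian. A power of Frobenius maps `L` into the separable closure of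
`F` in `L`, where the trace form bounds the integral closure, and Frobenius is finite on the
polynomial ring because `k` is perfect. -/
lemma isNoetherian_integralClosure_mvPolynomial (k σ F L : Type*) [Finite σ] [Field k]
    [PerfectField k] [Field F] [Field L] [Algebra (MvPolynomial σ k) F]
    [IsFractionRing (MvPolynomial σ k) F] [Algebra F L] [Algebra (MvPolynomial σ k) L]
    [IsScalarTower (MvPolynomial σ k) F L] [FiniteDimensional F L] :
    IsNoetherian (MvPolynomial σ k) (integralClosure (MvPolynomial σ k) L) := by
  let A := MvPolynomial σ k
  obtain ⟨p, hp⟩ := ExpChar.exists k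
  have : ExpChar A p := expChar_of_injective_ringHom (MvPolynomial.C_injective σ k) p
  have : ExpChar F p := expChar_of_injective_ringHom (IsFractionRing.injective A F) p
  let E := separableClosure F L
  have : ExpChar E p := expChar_of_injective_ringHom (algebraMap F E).injective p
  have : IsScalarTower A E L := IsScalarTower.of_algebraMap_eq fun x => rfl
  let n := IsPurelyInseparable.exponent E L
  let φ : L →+* E := IsPurelyInseparable.iterateFrobenius E L p le_rfl
  have hφ (x : L) : ((φ x : E) : L) = x ^ p ^ n :=
    IsPurelyInseparable.algebraMap_iterateFrobenius E p le_rfl x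
  have hint (x : L) (hx : x ∈ integralClosure A L) : φ x ∈ integralClosure A E := by
    change IsIntegral A (φ x)
    rw [← isIntegral_algebraMap_iff (algebraMap E L).injective]
    change IsIntegral A ((φ x : E) : L)
    rw [hφ]
    exact IsIntegral.pow hx _
  let g : integralClosure A L →+* integralClosure A E :=
    (φ.comp (integralClosure A L).val.toRingHom).codRestrict (integralClosure A E).toSubring
      (fun x => hint x x.2)
  have hE : Module.Finite A (integralClosure A E) :=
    IsIntegralClosure.finite A F E (integralClosure A E)
  refine isNoetherian_of_injective_of_finite_comp g ?_ ?_
  · intro x y hxy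
    exact Subtype.ext (φ.injective (congrArg Subtype.val hxy))
  · have h : g.comp (algebraMap A (integralClosure A L)) =
        (algebraMap A (integralClosure A E)).comp (iterateFrobenius A p n) := by
      refine RingHom.ext fun x => ?_
      apply Subtype.ext
      apply Subtype.ext
      refine (hφ (algebraMap A L x)).trans ?_
      rw [RingHom.comp_apply, iterateFrobenius_def, map_pow]
      change _ = algebraMap E L ((algebraMap A (integralClosure A E) x ^ p ^ n :
        integralClosure A E) : E)
      rw [SubmonoidClass.coe_pow, map_pow]
      congr 1
    rw [h]
    exact RingHom.Finite.comp (RingHom.finite_algebraMap.mpr hE)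
      (finite_iterateFrobenius_mvPolynomial k σ p n)

/-- The integral closure of a finitely generated domain `S` over a perfect field in a finitely
generated algebraic extension field is a Noetherian `S`-module. -/
lemma isNoetherian_integralClosure (k S L : Type*) [Field k] [PerfectField k] [CommRing S]
    [IsDomain S] [Field L] [Algebra k S] [Algebra k L] [Algebra S L] [IsScalarTower k S L]
    [Algebra.FiniteType k S] [FaithfulSMul S L] [Algebra.EssFiniteType k L]
    [Algebra.IsAlgebraic S L] : IsNoetherian S (integralClosure S L) := by
  -- Noether normalization: `S` is integral over a polynomial ring
  obtain ⟨d, g, hg, hint⟩ := exists_integral_inj_algHom_of_fg k S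
  let A := MvPolynomial (Fin d) k
  let : Algebra A S := g.toRingHom.toAlgebra
  let : Algebra A L := ((algebraMap S L).comp g.toRingHom).toAlgebra
  have : IsScalarTower A S L := IsScalarTower.of_algebraMap_eq fun x => rfl
  have : Algebra.IsIntegral A S := ⟨hint⟩
  have hAL : Function.Injective (algebraMap A L) :=
    (FaithfulSMul.algebraMap_injective S L).comp hg
  have : FaithfulSMul A S := (faithfulSMul_iff_algebraMap_injective A S).mpr hg
  have : FaithfulSMul A L := (faithfulSMul_iff_algebraMap_injective A L).mpr hAL
  let F := FractionRing A
  let : Algebra F L := FractionRing.liftAlgebra A L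
  have : IsScalarTower A F L := inferInstance
  have : IsScalarTower k A L := IsScalarTower.of_algebraMap_eq fun x => by
    rw [IsScalarTower.algebraMap_apply k S L, ← g.commutes]; rfl
  have : IsScalarTower k F L := IsScalarTower.of_algebraMap_eq fun x => by
    rw [IsScalarTower.algebraMap_apply k A L, IsScalarTower.algebraMap_apply A F L,
      IsScalarTower.algebraMap_apply k A F]
  have : Algebra.EssFiniteType F L := Algebra.EssFiniteType.of_comp k F L
  have : Algebra.IsAlgebraic A L := Algebra.IsAlgebraic.trans A S L
  have : Algebra.IsAlgebraic F L :=
    (IsFractionRing.comap_isAlgebraic_iff (A := A) (K := F) (C := L)).mp inferInstance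
  have : FiniteDimensional F L := Algebra.finite_of_essFiniteType_of_isAlgebraic
  have hN := isNoetherian_integralClosure_mvPolynomial k (Fin d) F L
  let ι : integralClosure S L →ₗ[A] integralClosure A L :=
    { toFun := fun x => ⟨x.1, isIntegral_trans (R := A) (A := S) x.1 x.2⟩
      map_add' := fun _ _ => rfl
      map_smul' := fun a x => Subtype.ext rfl }
  have : IsNoetherian A (integralClosure S L) := by
    refine isNoetherian_of_injective ι fun x y hxy => Subtype.ext ?_
    exact congrArg (fun z : integralClosure A L => (z : L)) hxy
  exact isNoetherian_of_tower A inferInstance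

end IntegralClosure

/-! ### Finite-dimensionality by valuations -/

section ValuativeFiniteness

open Polynomial

/-- The integral closure of a subring in a field is the intersection of the valuation rings
containing it. -/
lemma isIntegral_of_forall_valuationSubring {k L : Type*} [Field k] [Field L] [Algebra k L]
    (S : Subalgebra k L) (x : L)
    (h : ∀ R : ValuationSubring L, (∀ s ∈ S, s ∈ R) → x ∈ R) : IsIntegral S x := by
  have h1 : x ∈ (integralClosure (Subring.closure (S.toSubring : Set L)) L).toSubring := by
    rw [← iInf_valuationSubring_superset]
    simp only [Subring.mem_iInf]
    rintro ⟨R, hR⟩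
    exact h R hR
  rw [Subring.closure_eq] at h1
  exact h1

variable {k K : Type*} [Field k] [Field K] [Algebra k K]

/-- The `k`-subalgebra of `K(T)` generated by `mT`, `m ∈ M`. -/
noncomputable def reesAlgebra (k : Type*) {K : Type*} [Field k] [Field K] [Algebra k K]
    (M : Set K) : Subalgebra k (RatFunc K) :=
  Algebra.adjoin k ((fun m => algebraMap K[X] (RatFunc K) (C m * X)) '' M)

/-- The Rees algebra consists of polynomials in `T`, with constant coefficients in `k`. -/
lemma exists_polynomial_of_mem_reesAlgebra {M : Set K} {s : RatFunc K}
    (hs : s ∈ reesAlgebra k M) :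
    ∃ P : K[X], algebraMap K[X] (RatFunc K) P = s ∧ ∃ c : k, P.coeff 0 = algebraMap k K c := by
  induction hs using Algebra.adjoin_induction with
  | mem x hx =>
    obtain ⟨m, -, rfl⟩ := hx
    exact ⟨_, rfl, 0, by simp⟩
  | algebraMap r =>
    exact ⟨C (algebraMap k K r), by
      rw [IsScalarTower.algebraMap_apply k K[X] (RatFunc K)]; rfl, r, by simp⟩
  | add x y _ _ hx hy =>
    obtain ⟨P, rfl, c, hc⟩ := hx
    obtain ⟨Q, rfl, d, hd⟩ := hy
    exact ⟨P + Q, by simp, c + d, by simp [hc, hd]⟩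
  | mul x y _ _ hx hy =>
    obtain ⟨P, rfl, c, hc⟩ := hx
    obtain ⟨Q, rfl, d, hd⟩ := hy
    exact ⟨P * Q, by simp, c * d, by simp [hc, hd, mul_coeff_zero]⟩

lemma adjoin_reesAlgebra_eq_top {M : Set K} (h1 : 1 ∈ M)
    (hM : IntermediateField.adjoin k M = ⊤) :
    IntermediateField.adjoin k
      ((fun m => algebraMap K[X] (RatFunc K) (C m * X)) '' M) = ⊤ := by
  set E := IntermediateField.adjoin k ((fun m => algebraMap K[X] (RatFunc K) (C m * X)) '' M)
  have hmem (m : K) (hm : m ∈ M) : algebraMap K[X] (RatFunc K) (C m * X) ∈ E :=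
    IntermediateField.subset_adjoin _ _ ⟨m, hm, rfl⟩
  have hX : algebraMap K[X] (RatFunc K) X ∈ E := by simpa using hmem 1 h1
  have hX0 : algebraMap K[X] (RatFunc K) X ≠ 0 :=
    (map_ne_zero_iff _ (IsFractionRing.injective K[X] (RatFunc K))).mpr X_ne_zero
  have hC (a : K) : algebraMap K[X] (RatFunc K) (C a) ∈ E := by
    let ι : K →ₐ[k] RatFunc K := IsScalarTower.toAlgHom k K (RatFunc K)
    have h : (⊤ : IntermediateField k K) ≤ E.comap ι := by
      rw [← hM, IntermediateField.adjoin_le_iff]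
      intro m hm
      have h2 := E.div_mem (hmem m hm) hX
      rw [map_mul, mul_div_cancel_right₀ _ hX0] at h2
      exact h2
    exact h (IntermediateField.mem_top : a ∈ _)
  have hP (P : K[X]) : algebraMap K[X] (RatFunc K) P ∈ E := by
    induction P using Polynomial.induction_on' with
    | add p q hp hq => rw [map_add]; exact E.add_mem hp hq
    | monomial n a =>
      rw [← C_mul_X_pow_eq_monomial, map_mul, map_pow]
      exact E.mul_mem (hC a) (E.pow_mem hX n)
  refine top_le_iff.mp fun x _ => ?_
  rw [← RatFunc.num_div_denom x]
  exact E.div_mem (hP _) (hP _)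

/-- Let `K` be a finitely generated field over a perfect field `k` and `M` a finite subset of `K`.
The elements of `K` which lie in `⋃_{m ∈ M} R m` for every valuation ring `R` of `K / k` span a
finite-dimensional space: if `h` is such an element, then `hT` is integral over the algebra
generated by the `mT`, and integral closures of finitely generated domains are finite. -/
theorem finiteDimensional_of_forall_valuationSubring [PerfectField k] [Algebra.EssFiniteType k K]
    (M : Finset K) (V : Submodule k K)
    (hV : ∀ h ∈ V, ∀ R : ValuationSubring K, (∀ c : k, algebraMap k K c ∈ R) →
      ∃ m ∈ M, ∃ r ∈ R, h = r * m) : FiniteDimensional k V := by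
  classical
  -- enlarging `M` by `1` and generators of `K` makes `K(T)` the fraction field of the Rees algebra
  obtain ⟨G, hG⟩ := IntermediateField.fg_top k K
  set M' : Set K := insert 1 ((M : Set K) ∪ G) with hM'
  have hfin : M'.Finite := ((M.finite_toSet.union G.finite_toSet).insert 1)
  have htop : IntermediateField.adjoin k M' = ⊤ := by
    refine top_le_iff.mp (hG ▸ IntermediateField.adjoin.mono k _ _ ?_)
    exact fun x hx => Or.inr (Or.inr hx)
  let S := reesAlgebra k M'
  let L := RatFunc K
  let τ (a : K) : L := algebraMap K[X] (RatFunc K) (C a * X)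
  have hτ (a : K) (ha : a ∈ M') : τ a ∈ S := Algebra.subset_adjoin ⟨a, ha, rfl⟩
  have hadj := adjoin_reesAlgebra_eq_top (k := k) (M := M') (Set.mem_insert _ _) htop
  have : Algebra.FiniteType k S := by
    rw [← Subalgebra.fg_iff_finiteType]
    exact Subalgebra.fg_def.mpr ⟨_, hfin.image _, rfl⟩
  have : Algebra.EssFiniteType k L := by
    rw [← IntermediateField.fg_top_iff, ← hadj]
    exact IntermediateField.fg_adjoin_of_finite (hfin.image _)
  have : Algebra.IsAlgebraic S L := by
    refine ⟨fun x => ?_⟩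
    have hx : x ∈ IntermediateField.adjoin k ((fun m => algebraMap K[X] (RatFunc K) (C m * X)) ''
        M') := hadj ▸ IntermediateField.mem_top
    obtain ⟨r, hr, s, hs, rfl⟩ := (IntermediateField.mem_adjoin_iff_div).mp hx
    have h1 (y : L) (hy : y ∈ S) : IsAlgebraic S y := isAlgebraic_algebraMap (⟨y, hy⟩ : S)
    rw [div_eq_mul_inv]
    exact (h1 r hr).mul (h1 s hs).inv
  have : IsNoetherian S (integralClosure S L) := isNoetherian_integralClosure k S L
  have hint (h : K) (hh : h ∈ V) : IsIntegral S (τ h) := by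
    refine isIntegral_of_forall_valuationSubring S _ fun R hR => ?_
    let ι : K →+* L := algebraMap K L
    obtain ⟨m, hm, r, hr, rfl⟩ := hV h hh (R.comap ι) fun c => by
      change algebraMap K L (algebraMap k K c) ∈ R
      rw [← IsScalarTower.algebraMap_apply]
      exact hR _ (S.algebraMap_mem c)
    have h3 : τ (r * m) = ι r * τ m := by
      simp only [τ, mul_assoc, map_mul]
      rfl
    rw [h3]
    exact R.mul_mem _ _ hr (hR _ (hτ m (Or.inr (Or.inl hm))))
  have hle : Submodule.span S (τ '' (V : Set K)) ≤
      Subalgebra.toSubmodule (integralClosure S L) := by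
    rw [Submodule.span_le]
    rintro _ ⟨h, hh, rfl⟩
    exact hint h hh
  have hfg : (Submodule.span S (τ '' (V : Set K))).FG :=
    isNoetherian_submodule.mp (inferInstanceAs (IsNoetherian S (integralClosure S L))) _ hle
  obtain ⟨s, hs, hspan⟩ := (Submodule.fg_span_iff_fg_span_finset_subset _).mp hfg
  obtain ⟨t, htV, rfl⟩ := Finset.subset_set_image_iff.mp hs
  refine Submodule.finiteDimensional_of_le (S₂ := Submodule.span k (t : Set K)) fun h hh => ?_
  have h4 : τ h ∈ Submodule.span S (((t.image τ : Finset L)) : Set L) := by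
    rw [← hspan]
    exact Submodule.subset_span ⟨h, hh, rfl⟩
  rw [Finset.coe_image, Submodule.mem_span_image_finset_iff_exists_fun'] at h4
  obtain ⟨c, hc⟩ := h4
  choose P hP d hd using fun i => exists_polynomial_of_mem_reesAlgebra (c i).2
  have h5 : ∑ i ∈ t, P i * (C i * X) = C h * X := by
    apply IsFractionRing.injective K[X] (RatFunc K)
    rw [map_sum]
    refine Eq.trans (Finset.sum_congr rfl fun i _ => ?_) hc
    rw [map_mul, hP]
    rfl
  -- Comparing coefficients of `T` expresses `h` as a `k`-combination of elements of `t`.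
  have h6 : h = ∑ i ∈ t, d i • i := by
    have h7 := congrArg (fun Q : K[X] => Q.coeff 1) h5
    simp only [finsetSum_coeff, ← mul_assoc, coeff_mul_X, mul_coeff_zero, coeff_C_zero, hd] at h7
    simp only [Algebra.smul_def]
    exact h7.symm
  rw [h6]
  exact Submodule.sum_mem _ fun i hi => Submodule.smul_mem _ _ (Submodule.subset_span hi)

end ValuativeFiniteness

/-! ### Orbits of homeomorphisms -/

section HomeomorphOrbits

variable {X : Type*} [TopologicalSpace X]

/-- The orbit of a point under all integral powers of a homeomorphism. -/
def homeoOrbit (τ : X ≃ₜ X) (x : X) : Set X :=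
  Set.range fun n : ℤ => (τ ^ n) x

lemma mem_homeoOrbit_self (τ : X ≃ₜ X) (x : X) : x ∈ homeoOrbit τ x := ⟨0, rfl⟩

lemma homeo_mul_apply (τ τ' : X ≃ₜ X) (x : X) : (τ * τ') x = τ (τ' x) := rfl

lemma image_homeoOrbit (τ : X ≃ₜ X) (x : X) : τ '' homeoOrbit τ x = homeoOrbit τ x := by
  ext y
  constructor
  · rintro ⟨_, ⟨n, rfl⟩, rfl⟩
    exact ⟨1 + n, by simp [zpow_add]⟩
  · rintro ⟨n, rfl⟩
    refine ⟨_, ⟨-1 + n, rfl⟩, ?_⟩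
    simp only [← homeo_mul_apply, ← zpow_one_add]
    simp

lemma image_closure_homeoOrbit (τ : X ≃ₜ X) (x : X) :
    τ '' closure (homeoOrbit τ x) = closure (homeoOrbit τ x) := by
  rw [τ.image_closure, image_homeoOrbit]

lemma image_zpow_eq {τ : X ≃ₜ X} {F : Set X} (hF : τ '' F = F) (n : ℤ) : (τ ^ n) '' F = F := by
  induction n with
  | zero => exact Set.image_id F
  | succ n ih =>
    rw [zpow_add_one]
    change (fun x => (τ ^ (n : ℤ)) (τ x)) '' F = F
    rw [← Set.image_image (τ ^ (n : ℤ)) τ, hF, ih]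
  | pred n ih =>
    rw [zpow_sub_one]
    change (fun x => (τ ^ (-n : ℤ)) (τ.symm x)) '' F = F
    have h : τ.symm '' F = F := by
      conv_lhs => rw [← hF]
      rw [Set.image_image]
      simp
    rw [← Set.image_image (τ ^ (-n : ℤ)) τ.symm, h, ih]

lemma homeoOrbit_subset {τ : X ≃ₜ X} {F : Set X} (hF : τ '' F = F) {x : X} (hx : x ∈ F) :
    homeoOrbit τ x ⊆ F := by
  rintro _ ⟨n, rfl⟩
  rw [← image_zpow_eq hF n]
  exact ⟨x, hx, rfl⟩

end HomeomorphOrbits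

/-! ### Eigenvectors, relations and monomials -/

section LinearAlgebra

/-- An endomorphism preserving finite-dimensional subspaces `I ⊆ J`, `J ⊄ I`, of a vector space
over an algebraically closed field has an eigenvector in `J` modulo `I`. -/
lemma exists_eigenvector_mod {k V : Type*} [Field k] [IsAlgClosed k] [AddCommGroup V] [Module k V]
    (φ : V →ₗ[k] V) (I J : Submodule k V) [FiniteDimensional k J] (hI : ∀ v ∈ I, φ v ∈ I)
    (hJ : ∀ v ∈ J, φ v ∈ J) (hJI : ¬ J ≤ I) :
    ∃ v ∈ J, v ∉ I ∧ ∃ c : k, φ v - c • v ∈ I := by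
  let I' : Submodule k J := I.submoduleOf J
  let ψ : J →ₗ[k] J := φ.restrict hJ
  have hψ : I' ≤ I'.comap ψ := fun v hv => hI v hv
  have : Nontrivial (J ⧸ I') := by
    rw [Submodule.Quotient.nontrivial_iff]
    intro h
    exact hJI (Submodule.submoduleOf_eq_top.mp h)
  obtain ⟨c, hc⟩ := Module.End.exists_eigenvalue (K := k) (I'.mapQ I' ψ hψ)
  obtain ⟨v, hv⟩ := hc.exists_hasEigenvector
  obtain ⟨v, rfl⟩ := I'.mkQ_surjective v
  refine ⟨v, v.2, fun h => hv.2 ?_, c, ?_⟩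
  · exact (Submodule.Quotient.mk_eq_zero I').mpr h
  · have h := hv.apply_eq_smul
    rw [← map_smul] at h
    exact (Submodule.Quotient.eq I').mp h

/-- Eigenvectors modulo an invariant subspace with distinct eigenvalues are linearly independent. -/
lemma linearIndependent_of_eigenvector_mod {k V ι : Type*} [Field k] [AddCommGroup V] [Module k V]
    (φ : V →ₗ[k] V) (I : Submodule k V) (hI : ∀ v ∈ I, φ v ∈ I) (c : ι → k)
    (hc : Function.Injective c) (v : ι → V) (hv : ∀ i, v i ∉ I)
    (h : ∀ i, φ (v i) - c i • v i ∈ I) : LinearIndependent k v := by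
  refine LinearIndependent.of_comp I.mkQ ?_
  refine Module.End.eigenvectors_linearIndependent' (I.mapQ I φ hI) c hc _ fun i => ?_
  rw [Module.End.hasEigenvector_iff, Module.End.mem_eigenspace_iff]
  refine ⟨?_, fun h0 => hv i ((Submodule.Quotient.mk_eq_zero I).mp h0)⟩
  exact (Submodule.Quotient.eq I).mpr (h i)

/-- Over `ℕ`, a vector outside a maximal linearly independent family into a cancellative monoid
enters with a positive multiple into some relation. -/
lemma exists_relation_of_not_linearIndepOn_insert {ι M : Type*} [AddCancelCommMonoid M] (v : ι → M)
    {s : Set ι} {e : ι} (hs : LinearIndepOn ℕ v s)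
    (hse : ¬ LinearIndepOn ℕ v (insert e s)) :
    ∃ n : ℕ, 0 < n ∧ ∃ f ∈ Finsupp.supported ℕ ℕ s, ∃ g ∈ Finsupp.supported ℕ ℕ s,
      n • v e + Finsupp.linearCombination ℕ v f = Finsupp.linearCombination ℕ v g := by
  classical
  rw [linearIndepOn_iffₛ] at hs hse
  push Not at hse
  obtain ⟨f, hf, g, hg, hfg, hne⟩ := hse
  have hsupp (f : ι →₀ ℕ) (hf : f ∈ Finsupp.supported ℕ ℕ (insert e s)) :
      f.erase e ∈ Finsupp.supported ℕ ℕ s := by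
    rw [Finsupp.mem_supported] at hf ⊢
    intro i hi
    rw [Finsupp.support_erase, Finset.coe_erase] at hi
    exact (hf hi.1).resolve_left hi.2
  have hsplit (f : ι →₀ ℕ) : Finsupp.linearCombination ℕ v f =
      f e • v e + Finsupp.linearCombination ℕ v (f.erase e) := by
    conv_lhs => rw [← Finsupp.single_add_erase e f]
    rw [map_add, Finsupp.linearCombination_single]
  have key (f g : ι →₀ ℕ) (hfg : Finsupp.linearCombination ℕ v f =
      Finsupp.linearCombination ℕ v g) (h : g e ≤ f e) :
      (f e - g e) • v e + Finsupp.linearCombination ℕ v (f.erase e) =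
        Finsupp.linearCombination ℕ v (g.erase e) := by
    apply add_left_cancel (a := g e • v e)
    rw [← hsplit g, ← hfg, hsplit f, ← add_assoc, ← add_smul, Nat.add_sub_cancel' h]
  rcases lt_trichotomy (f e) (g e) with h | h | h
  · exact ⟨_, Nat.sub_pos_of_lt h, _, hsupp g hg, _, hsupp f hf, key g f hfg.symm h.le⟩
  · refine absurd ?_ hne
    have h1 := key f g hfg h.ge
    rw [h, Nat.sub_self, zero_smul, zero_add] at h1
    have h2 := hs _ (hsupp f hf) _ (hsupp g hg) h1
    rw [← Finsupp.single_add_erase e f, ← Finsupp.single_add_erase e g, h2, h]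
  · exact ⟨_, Nat.sub_pos_of_lt h, _, hsupp f hf, _, hsupp g hg, key f g hfg h.le⟩

/-- Elements of a `k`-algebra whose monomials are linearly independent over `k` are algebraically
independent. -/
lemma algebraicIndependent_of_linearIndependent_monomials {k A ι : Type*} [Field k] [CommRing A]
    [Algebra k A] (x : ι → A)
    (h : LinearIndependent k fun f : ι →₀ ℕ => f.prod fun i n => x i ^ n) :
    AlgebraicIndependent k x := by
  rw [algebraicIndependent_iff]
  intro p hp
  rw [linearIndependent_iff'] at h
  have h1 : ∑ f ∈ p.support, p.coeff f • (f.prod fun i n => x i ^ n) = 0 := by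
    rw [← hp, MvPolynomial.aeval_def, MvPolynomial.eval₂_eq]
    exact Finset.sum_congr rfl fun f _ => Algebra.smul_def _ _
  ext f
  by_cases hf : f ∈ p.support
  · exact h _ _ h1 f hf
  · simpa using hf

end LinearAlgebra

/-! ### Linearized sections and their eigensections -/

section Eigensections

open Polynomial

/-- The formal properties of the spaces `H⁰(X, rD) ⊆ K(X)` of sections of the multiples of a
divisor `D`, of their zero loci, and of a linearization `φ` of a homeomorphism `τ` of `X`: the
section `φ r a` vanishes at `x` if and only if `a` vanishes at `τ x`. The set `zero r a` has
meaning only for `a ∈ sec r`; the field `exists_mem_zero_sub` says that the values of two sections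
at a closed point differ by a constant factor. -/
structure LinearizedSections (k K : Type*) {X : Type*} [Field k] [Field K] [Algebra k K]
    [TopologicalSpace X] (τ : X ≃ₜ X) where
  sec : ℕ → Submodule k K
  finiteDimensional_sec : ∀ r, FiniteDimensional k (sec r)
  one_mem : 1 ∈ sec 0
  mul_mem : ∀ {r s a b}, a ∈ sec r → b ∈ sec s → a * b ∈ sec (r + s)
  zero : ℕ → K → Set X
  isClosed_zero : ∀ {r a}, a ∈ sec r → IsClosed (zero r a)
  zero_zero : ∀ r, zero r 0 = Set.univ
  zero_one : zero 0 1 = ∅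
  zero_mul : ∀ {r s a b}, a ∈ sec r → b ∈ sec s → zero (r + s) (a * b) = zero r a ∪ zero s b
  zero_add : ∀ {r a b}, a ∈ sec r → b ∈ sec r → zero r a ∩ zero r b ⊆ zero r (a + b)
  zero_smul : ∀ {r a} (c : k), a ∈ sec r → zero r a ⊆ zero r (c • a)
  exists_mem_zero_sub : ∀ {r a b x}, IsClosed {x} → a ∈ sec r → b ∈ sec r → x ∉ zero r b →
    ∃ c : k, x ∈ zero r (a - c • b)
  φ : ℕ → K →ₗ[k] K
  φ_mem : ∀ {r a}, a ∈ sec r → φ r a ∈ sec r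
  φ_one : φ 0 1 = 1
  φ_mul : ∀ {r s} (a b), φ (r + s) (a * b) = φ r a * φ s b
  zero_φ : ∀ {r a}, a ∈ sec r → zero r (φ r a) = τ ⁻¹' zero r a

namespace LinearizedSections

variable {k K X : Type*} [Field k] [Field K] [Algebra k K] [TopologicalSpace X] {τ : X ≃ₜ X}
  (S : LinearizedSections k K τ)

/-- The iterates of a linearization of `τ` linearize the iterates of `τ`. -/
def iterate (n : ℕ) : LinearizedSections k K (τ ^ n) where
  __ := S
  φ r := S.φ r ^ n
  φ_mem {r a} ha := by
    induction n with
    | zero => exact ha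
    | succ n ih => rw [pow_succ']; exact S.φ_mem ih
  φ_one := by
    induction n with
    | zero => rfl
    | succ n ih => rw [pow_succ', Module.End.mul_apply, ih, S.φ_one]
  φ_mul {r s} a b := by
    induction n with
    | zero => rfl
    | succ n ih => simp only [pow_succ', Module.End.mul_apply, ih, S.φ_mul]
  zero_φ {r a} ha := by
    induction n generalizing a with
    | zero => rfl
    | succ n ih =>
      rw [pow_succ, Module.End.mul_apply, ih (S.φ_mem ha), S.zero_φ ha, pow_succ']
      rfl

/-- The subspace of sections vanishing on a set. -/
def vanishing (r : ℕ) (Y : Set X) : Submodule k K where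
  carrier := {a | a ∈ S.sec r ∧ Y ⊆ S.zero r a}
  zero_mem' := ⟨zero_mem _, by rw [S.zero_zero]; exact Set.subset_univ _⟩
  add_mem' ha hb :=
    ⟨add_mem ha.1 hb.1, (Set.subset_inter ha.2 hb.2).trans (S.zero_add ha.1 hb.1)⟩
  smul_mem' c _ ha := ⟨Submodule.smul_mem _ c ha.1, ha.2.trans (S.zero_smul c ha.1)⟩

variable {S}

lemma mem_vanishing {r : ℕ} {Y : Set X} {a : K} :
    a ∈ S.vanishing r Y ↔ a ∈ S.sec r ∧ Y ⊆ S.zero r a := Iff.rfl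

lemma finiteDimensional_vanishing (r : ℕ) (Y : Set X) :
    FiniteDimensional k (S.vanishing r Y) :=
  have := S.finiteDimensional_sec r
  Submodule.finiteDimensional_of_le (fun _ h => h.1 : S.vanishing r Y ≤ S.sec r)

lemma φ_mem_vanishing_iff {r : ℕ} {Y : Set X} (hY : τ '' Y = Y) {a : K} (ha : a ∈ S.sec r) :
    S.φ r a ∈ S.vanishing r Y ↔ a ∈ S.vanishing r Y := by
  rw [mem_vanishing, mem_vanishing, S.zero_φ ha, ← Set.image_subset_iff, hY]
  exact and_congr_left fun _ => ⟨fun _ => ha, S.φ_mem⟩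

variable (S)

/-- The multiplicative monoid of triples `(r, a, c)`, where `a` is a section of degree `r` which
does not vanish identically on the irreducible set `W` and is an eigenvector of eigenvalue `c` of
the linearization, modulo sections vanishing on `W`. -/
def eigenMonoid {W : Set X} (hW : IsIrreducible W) :
    Submonoid (Multiplicative ℕ × K × kˣ) where
  carrier := {e | e.2.1 ∈ S.sec e.1.toAdd ∧ e.2.1 ∉ S.vanishing e.1.toAdd W ∧
    S.φ e.1.toAdd e.2.1 - (e.2.2 : k) • e.2.1 ∈ S.vanishing e.1.toAdd W}
  one_mem' := by
    refine ⟨S.one_mem, fun h => ?_, ?_⟩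
    · have h2 : W ⊆ S.zero 0 1 := h.2
      rw [S.zero_one] at h2
      exact hW.1.ne_empty (Set.subset_empty_iff.mp h2)
    · change S.φ 0 1 - (1 : k) • 1 ∈ S.vanishing 0 W
      rw [S.φ_one, one_smul, sub_self]
      exact zero_mem _
  mul_mem' := by
    rintro ⟨r, a, c⟩ ⟨s, b, d⟩ ⟨ha, ha', hac⟩ ⟨hb, hb', hbd⟩
    change a * b ∈ S.sec (r.toAdd + s.toAdd) ∧ a * b ∉ S.vanishing (r.toAdd + s.toAdd) W ∧
      S.φ (r.toAdd + s.toAdd) (a * b) - ((c * d : kˣ) : k) • (a * b) ∈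
        S.vanishing (r.toAdd + s.toAdd) W
    dsimp only at *
    refine ⟨S.mul_mem ha hb, fun h => ?_, ?_⟩
    · have h2 := h.2
      rw [S.zero_mul ha hb] at h2
      rcases isPreirreducible_iff_isClosed_union_isClosed.mp hW.2 _ _ (S.isClosed_zero ha)
        (S.isClosed_zero hb) h2 with h3 | h3
      exacts [ha' ⟨ha, h3⟩, hb' ⟨hb, h3⟩]
    · -- the error terms of `a` and `b` vanish on `W`, and so do their multiples
      have h1 : S.φ (r.toAdd + s.toAdd) (a * b) - ((c * d : kˣ) : k) • (a * b) =
          S.φ r.toAdd a * (S.φ s.toAdd b - (d : k) • b) +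
            (S.φ r.toAdd a - (c : k) • a) * ((d : k) • b) := by
        rw [S.φ_mul, Units.val_mul, mul_smul]
        simp only [Algebra.smul_def]
        ring
      rw [h1]
      refine add_mem ⟨S.mul_mem (S.φ_mem ha) hbd.1, ?_⟩
        ⟨S.mul_mem hac.1 (Submodule.smul_mem _ _ hb), ?_⟩
      · rw [S.zero_mul (S.φ_mem ha) hbd.1]
        exact hbd.2.trans Set.subset_union_right
      · rw [S.zero_mul hac.1 (Submodule.smul_mem _ _ hb)]
        exact hac.2.trans Set.subset_union_left

/-- The zero locus of the section underlying an eigensection. -/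
def eigenZero (e : Multiplicative ℕ × K × kˣ) : Set X := S.zero e.1.toAdd e.2.1

/-- The degree and the eigenvalue of an eigensection. -/
def eigenCharacter (k K : Type*) [Field k] [Field K] :
    Multiplicative ℕ × K × kˣ →* Multiplicative ℕ × kˣ :=
  (MonoidHom.fst _ _).prod ((MonoidHom.snd _ _).comp (MonoidHom.snd _ _))

variable {S} {W : Set X} {hW : IsIrreducible W}

/-- Eigensections with distinct characters are linearly independent, when sections of degree `r`
are regarded as homogeneous elements `a T ^ r` of `K[T]`. -/
lemma linearIndependent_of_injective_eigenCharacter (hτ : τ '' W = W) {ι : Type*}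
    (e : ι → S.eigenMonoid hW)
    (he : Function.Injective fun i => eigenCharacter k K (e i)) :
    LinearIndependent k fun i => (C (e i).1.2.1 * Polynomial.X ^ (e i).1.1.toAdd : K[X]) := by
  classical
  rw [linearIndependent_iff']
  intro t g hg i hi
  set r := (e i).1.1.toAdd with hr
  have h1 : ∑ j ∈ t with (e j).1.1.toAdd = r, g j • (e j).1.2.1 = 0 := by
    have h2 := congrArg (fun P : K[X] => P.coeff r) hg
    simp only [finsetSum_coeff, coeff_smul, coeff_C_mul_X_pow, coeff_zero] at h2
    refine (Finset.sum_filter _ _).trans ((Finset.sum_congr rfl fun j _ => ?_).trans h2)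
    rw [smul_ite, smul_zero]
    exact if_congr eq_comm rfl rfl
  have h3 : LinearIndependent k
      fun j : {j // (e j).1.1.toAdd = r} => (e j.1).1.2.1 := by
    refine linearIndependent_of_eigenvector_mod (S.φ r) (S.vanishing r W)
      (fun v hv => (φ_mem_vanishing_iff hτ hv.1).mpr hv)
      (fun j => ((e j.1).1.2.2 : k)) ?_ _ ?_ ?_
    · intro j j' h
      apply Subtype.ext
      apply he
      refine Prod.ext ?_ (Units.ext h)
      exact Multiplicative.toAdd.injective (j.2.trans j'.2.symm)
    · rintro ⟨j, hj⟩
      have := (e j).2.2.1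
      rwa [hj] at this
    · rintro ⟨j, hj⟩
      have := (e j).2.2.2
      rwa [hj] at this
  rw [linearIndependent_iff'] at h3
  refine h3 (t.subtype _) (fun j => g j.1) ?_ ⟨i, rfl⟩ (by simpa using hi)
  rw [← h1, Finset.sum_subtype_eq_sum_filter (f := fun j => g j • (e j).1.2.1)]

/-- The monomial in eigensections with a given exponent vector. -/
noncomputable def eigenMonomial (f : S.eigenMonoid hW →₀ ℕ) : S.eigenMonoid hW :=
  f.prod fun e n => e ^ n

lemma linearCombination_eigenCharacter (f : S.eigenMonoid hW →₀ ℕ) :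
    Finsupp.linearCombination ℕ
      (fun e : S.eigenMonoid hW => Additive.ofMul (eigenCharacter k K e)) f =
      Additive.ofMul (eigenCharacter k K (eigenMonomial f)) := by
  rw [eigenMonomial, Finsupp.linearCombination_apply, Finsupp.prod, Finsupp.sum,
    SubmonoidClass.coe_finsetProd, map_prod, ofMul_prod]
  refine Finset.sum_congr rfl fun e _ => ?_
  rw [SubmonoidClass.coe_pow, map_pow, ofMul_pow]

lemma exists_mem_eigenZero_of_eigenMonomial (f : S.eigenMonoid hW →₀ ℕ) {x : X}
    (hx : x ∈ S.eigenZero (eigenMonomial f).1) :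
    ∃ e ∈ f.support, x ∈ S.eigenZero e.1 := by
  by_contra! h
  let P : Submonoid (S.eigenMonoid hW) :=
    { carrier := {e | x ∉ S.eigenZero e.1}
      one_mem' := fun h => by
        have h' : x ∈ S.zero 0 1 := h
        rwa [S.zero_one] at h'
      mul_mem' := fun {e e'} he he' h => by
        have h' : x ∈ S.zero _ _ := h
        erw [S.zero_mul e.2.1 e'.2.1] at h'
        exact h'.elim he he' }
  exact P.prod_mem (fun e he => P.pow_mem (h e he) (f e)) hx

lemma eigenZero_mul (e e' : S.eigenMonoid hW) :
    S.eigenZero (e * e').1 = S.eigenZero e.1 ∪ S.eigenZero e'.1 :=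
  S.zero_mul e.2.1 e'.2.1

/-- Families of eigensections with `ℕ`-independent characters are algebraically independent, so
that their cardinality is bounded by the transcendence degree of `K(T)`. -/
lemma finite_of_linearIndepOn_eigenCharacter [Algebra.EssFiniteType k K] (hτ : τ '' W = W)
    {s : Set (S.eigenMonoid hW)}
    (hs : LinearIndepOn ℕ
      (fun e : S.eigenMonoid hW => Additive.ofMul (eigenCharacter k K e)) s) : s.Finite := by
  let y (e : S.eigenMonoid hW) : K[X] := C e.1.2.1 * Polynomial.X ^ e.1.1.toAdd
  let Y : S.eigenMonoid hW →* K[X] :=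
    { toFun := y
      map_one' := by
        change C (1 : K) * Polynomial.X ^ 0 = 1
        simp
      map_mul' := fun e e' => by
        change C (e.1.2.1 * e'.1.2.1) * Polynomial.X ^ (e.1.1.toAdd + e'.1.1.toAdd) = _
        simp only [y, C_mul, pow_add]
        ring }
  have h1 : AlgebraicIndependent k fun e : s => y e.1 := by
    apply algebraicIndependent_of_linearIndependent_monomials
    let emb : (s →₀ ℕ) → (S.eigenMonoid hW →₀ ℕ) := fun f => f.mapDomain Subtype.val
    have h2 : LinearIndependent k fun f : s →₀ ℕ => y (eigenMonomial (emb f)) := by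
      refine linearIndependent_of_injective_eigenCharacter hτ _ fun f g hfg => ?_
      apply hs
      have h3 (f : s →₀ ℕ) := Finsupp.linearCombination_mapDomain ℕ
        (v' := fun e : S.eigenMonoid hW => Additive.ofMul (eigenCharacter k K e))
        (Subtype.val : s → S.eigenMonoid hW) f
      refine (h3 f).symm.trans (Eq.trans ?_ (h3 g))
      rw [linearCombination_eigenCharacter, linearCombination_eigenCharacter]
      exact congrArg Additive.ofMul hfg
    have h3 : (fun f : s →₀ ℕ => f.prod fun e n => y e.1 ^ n) =
        fun f => y (eigenMonomial (emb f)) := by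
      funext f
      change _ = Y (eigenMonomial (emb f))
      rw [eigenMonomial, Finsupp.prod_mapDomain_index_inj Subtype.val_injective]
      refine Eq.trans ?_ (map_prod Y _ _).symm
      exact Finset.prod_congr rfl fun e _ => (map_pow Y e.1 _).symm
    rw [h3]
    exact h2
  have h2 : AlgebraicIndependent k fun e : s => algebraMap K[X] (RatFunc K) (y e.1) :=
    (h1.map' (f := IsScalarTower.toAlgHom k K[X] (RatFunc K))
      (IsFractionRing.injective K[X] (RatFunc K)))
  have : FinTrdeg K (RatFunc K) := by
    have : Algebra.EssFiniteType K[X] (RatFunc K) :=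
      Algebra.EssFiniteType.of_isLocalization (RatFunc K) (nonZeroDivisors K[X])
    have : Algebra.EssFiniteType K (RatFunc K) := Algebra.EssFiniteType.comp K K[X] (RatFunc K)
    infer_instance
  have : FinTrdeg k (RatFunc K) := FinTrdeg.trans k K (RatFunc K)
  exact Set.finite_coe_iff.mp (finite_of_algebraicIndependent h2)

end LinearizedSections
end Eigensections

/-! ### Dense orbits and eigensections -/

section DenseOrbits
namespace LinearizedSections

variable {k K X : Type*} [Field k] [Field K] [Algebra k K] [TopologicalSpace X] {τ : X ≃ₜ X}
  {S : LinearizedSections k K τ} {W : Set X} {hW : IsIrreducible W}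

/-- The zero locus of an eigensection is invariant, so it contains no point with dense orbit. -/
lemma notMem_eigenZero_of_dense (hτ : τ '' W = W) (e : S.eigenMonoid hW) {w : X} (hw : w ∈ W)
    (hd : closure (homeoOrbit τ w) = W) : w ∉ S.eigenZero e.1 := by
  intro h
  have hcl : IsClosed (S.eigenZero e.1) := S.isClosed_zero e.2.1
  have hmem (x : X) (hx : x ∈ W) : x ∈ S.eigenZero e.1 ↔ τ x ∈ S.eigenZero e.1 := by
    have h1 : τ x ∈ S.eigenZero e.1 ↔ x ∈ S.zero e.1.1.toAdd (S.φ e.1.1.toAdd e.1.2.1) := by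
      rw [S.zero_φ e.2.1]; rfl
    have h2 := e.2.2.2.2 hx
    have hca := Submodule.smul_mem _ (e.1.2.2 : k) e.2.1
    rw [h1]
    constructor
    · intro h3
      have h4 := S.zero_add e.2.2.2.1 hca ⟨h2, S.zero_smul _ e.2.1 h3⟩
      rwa [sub_add_cancel] at h4
    · intro h3
      have h4 := S.zero_add (S.φ_mem e.2.1) (Submodule.smul_mem _ (-1 : k) e.2.2.2.1)
        ⟨h3, S.zero_smul _ e.2.2.2.1 h2⟩
      rw [neg_one_smul, neg_sub, add_sub_cancel] at h4
      have h5 := S.zero_smul ((e.1.2.2⁻¹ : kˣ) : k) hca h4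
      rwa [smul_smul, Units.inv_mul, one_smul] at h5
  have hinv : τ '' (S.eigenZero e.1 ∩ W) = S.eigenZero e.1 ∩ W := by
    ext y
    constructor
    · rintro ⟨x, ⟨hx, hxW⟩, rfl⟩
      exact ⟨(hmem x hxW).mp hx, hτ ▸ ⟨x, hxW, rfl⟩⟩
    · rintro ⟨hy, hyW⟩
      rw [← hτ] at hyW
      obtain ⟨x, hxW, rfl⟩ := hyW
      exact ⟨x, ⟨(hmem x hxW).mpr hy, hxW⟩, rfl⟩
  have h6 : W ⊆ S.eigenZero e.1 := by
    conv_lhs => rw [← hd]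
    exact closure_minimal ((homeoOrbit_subset hinv ⟨h, hw⟩).trans Set.inter_subset_left) hcl
  exact e.2.2.1 ⟨e.2.1, h6⟩

/-- If the orbit of a point of `W` is not dense and some section vanishes on it but not on `W`, then
some eigensection vanishes at this point: the sections which vanish on the orbit form an invariant
finite-dimensional space. -/
lemma exists_mem_eigenZero_of_not_dense [IsAlgClosed k] (hτ : τ '' W = W) {w : X} {r : ℕ} {a : K}
    (ha : a ∈ S.vanishing r (closure (homeoOrbit τ w))) (haW : a ∉ S.vanishing r W) :
    ∃ e : S.eigenMonoid hW, w ∈ S.eigenZero e.1 := by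
  have := finiteDimensional_vanishing (S := S) r (closure (homeoOrbit τ w))
  obtain ⟨v, hv, hvW, c, hc⟩ := exists_eigenvector_mod (S.φ r) (S.vanishing r W)
    (S.vanishing r (closure (homeoOrbit τ w)))
    (fun v hv => (φ_mem_vanishing_iff hτ hv.1).mpr hv)
    (fun v hv => (φ_mem_vanishing_iff (image_closure_homeoOrbit τ w) hv.1).mpr hv)
    (fun h => haW (h ha))
  -- an eigenvalue `0` would make `v` vanish on `W`, as `φ v` vanishes on `W` only if `v` does
  have hc0 : c ≠ 0 := by
    rintro rfl
    rw [_root_.zero_smul, sub_zero, φ_mem_vanishing_iff hτ hv.1] at hc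
    exact hvW hc
  exact ⟨⟨(Multiplicative.ofAdd r, v, Units.mk0 c hc0), hv.1, hvW, hc⟩,
    hv.2 (subset_closure (mem_homeoOrbit_self τ w))⟩

/-- If some closed point has a dense orbit, eigensections with the same character have the same
zeros on `W`: a suitable linear combination vanishes at that point, hence on `W`. -/
lemma eigenZero_inter_subset_of_eigenCharacter_eq (hτ : τ '' W = W) {w₀ : X}
    (hcl : IsClosed {w₀}) (hw₀ : w₀ ∈ W) (hd : closure (homeoOrbit τ w₀) = W)
    (e e' : S.eigenMonoid hW) (h : eigenCharacter k K e.1 = eigenCharacter k K e'.1) :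
    S.eigenZero e.1 ∩ W ⊆ S.eigenZero e'.1 := by
  obtain ⟨⟨r, a, c⟩, ha, haW, hac⟩ := e
  obtain ⟨⟨r', b, c'⟩, hb, hbW, hbc⟩ := e'
  obtain rfl : r = r' := congrArg Prod.fst h
  obtain rfl : c = c' := congrArg Prod.snd h
  have hb₀ : w₀ ∉ S.zero r.toAdd b :=
    notMem_eigenZero_of_dense (S := S) (hW := hW) hτ ⟨(r, b, c), hb, hbW, hbc⟩ hw₀ hd
  obtain ⟨t, ht⟩ := S.exists_mem_zero_sub hcl hb ha
    (notMem_eigenZero_of_dense (S := S) (hW := hW) hτ ⟨(r, a, c), ha, haW, hac⟩ hw₀ hd)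
  dsimp only at *
  have hta : t • a ∈ S.sec r.toAdd := Submodule.smul_mem _ _ ha
  have hsub : b - t • a ∈ S.sec r.toAdd := sub_mem hb hta
  have hzero : b - t • a ∈ S.vanishing r.toAdd W := by
    by_contra hne
    refine notMem_eigenZero_of_dense (S := S) (hW := hW) hτ
      ⟨(r, b - t • a, c), hsub, hne, ?_⟩ hw₀ hd ht
    have h1 : S.φ r.toAdd (b - t • a) - (c : k) • (b - t • a) =
        (S.φ r.toAdd b - (c : k) • b) - t • (S.φ r.toAdd a - (c : k) • a) := by
      rw [map_sub, map_smul, smul_sub, smul_sub, smul_comm]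
      abel
    rw [h1]
    exact sub_mem hbc (Submodule.smul_mem _ _ hac)
  rintro w ⟨hwe, hwW⟩
  have h2 := S.zero_add hsub hta ⟨hzero.2 hwW, S.zero_smul t ha hwe⟩
  rwa [sub_add_cancel] at h2

/-- If some closed point of `W` has a dense orbit, then the zero loci on `W` of all eigensections
are contained in those of finitely many. -/
lemma exists_finite_eigenZero [Algebra.EssFiniteType k K] (hτ : τ '' W = W) {w₀ : X}
    (hcl : IsClosed {w₀}) (hw₀ : w₀ ∈ W) (hd : closure (homeoOrbit τ w₀) = W) :
    ∃ s : Set (S.eigenMonoid hW), s.Finite ∧ ∀ (e : S.eigenMonoid hW) (w : X), w ∈ W →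
      w ∈ S.eigenZero e.1 → ∃ e' ∈ s, w ∈ S.eigenZero e'.1 := by
  obtain ⟨s, hs, hmax⟩ := exists_maximal_linearIndepOn' ℕ
    fun e : S.eigenMonoid hW => Additive.ofMul (eigenCharacter k K e)
  refine ⟨s, finite_of_linearIndepOn_eigenCharacter hτ hs, fun e w hwW hw => ?_⟩
  by_cases hes : e ∈ s
  · exact ⟨e, hes, hw⟩
  -- `e ^ n` times a monomial in `s` has the character, hence the zeros, of a monomial in `s`
  obtain ⟨n, hn, f, -, g, hg, hfg⟩ := exists_relation_of_not_linearIndepOn_insert _ hs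
    (fun h => hes (hmax _ (Set.subset_insert e s) h ▸ Set.mem_insert e s))
  rw [linearCombination_eigenCharacter, linearCombination_eigenCharacter, ← ofMul_pow,
    ← ofMul_mul, ← map_pow, ← map_mul] at hfg
  have h1 : w ∈ S.eigenZero (e ^ n * eigenMonomial f).1 := by
    obtain ⟨m, rfl⟩ := Nat.exists_eq_add_of_lt hn
    rw [_root_.zero_add, pow_succ', mul_assoc, eigenZero_mul]
    exact Or.inl hw
  have h2 := eigenZero_inter_subset_of_eigenCharacter_eq hτ hcl hw₀ hd (e ^ n * eigenMonomial f)
    (eigenMonomial g) (Additive.ofMul.injective hfg) ⟨h1, hwW⟩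
  obtain ⟨e', he', hwe'⟩ := exists_mem_eigenZero_of_eigenMonomial g h2
  exact ⟨e', hg he', hwe'⟩

/-- If every proper closed subset of `W` is contained in the zero locus of a section not
vanishing on `W`, then the closed points of `W` with dense orbit form an open set: they are the
closed points at which none of finitely many eigensections vanish. -/
theorem exists_isOpen_dense_iff [IsAlgClosed k] [Algebra.EssFiniteType k K]
    (S : LinearizedSections k K τ) (hW : IsIrreducible W) (hWcl : IsClosed W) (hτ : τ '' W = W)
    (hsep : ∀ Y ⊂ W, IsClosed Y → ∃ r, ∃ a ∈ S.vanishing r Y, a ∉ S.vanishing r W) :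
    ∃ V : Set X, IsOpen V ∧
      ∀ w ∈ W, IsClosed {w} → (closure (homeoOrbit τ w) = W ↔ w ∈ V) := by
  by_cases h : ∃ w₀ ∈ W, IsClosed {w₀} ∧ closure (homeoOrbit τ w₀) = W
  · obtain ⟨w₀, hw₀, hcl, hd⟩ := h
    obtain ⟨s, hs, hs'⟩ := exists_finite_eigenZero (S := S) (hW := hW) hτ hcl hw₀ hd
    refine ⟨(⋃ e ∈ s, S.eigenZero e.1)ᶜ,
      (hs.isClosed_biUnion fun e _ => S.isClosed_zero e.2.1).isOpen_compl, fun w hw _ => ?_⟩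
    simp only [Set.mem_compl_iff, Set.mem_iUnion, exists_prop, not_exists, not_and]
    refine ⟨fun hwd e _ => notMem_eigenZero_of_dense hτ e hw hwd, fun hwe => ?_⟩
    by_contra hwd
    have hsub : closure (homeoOrbit τ w) ⊆ W := closure_minimal (homeoOrbit_subset hτ hw) hWcl
    obtain ⟨r, a, ha, haW⟩ := hsep _ (hsub.ssubset_of_ne hwd) isClosed_closure
    obtain ⟨e, he⟩ := exists_mem_eigenZero_of_not_dense (hW := hW) hτ ha haW
    obtain ⟨e', he', hwe'⟩ := hs' e w hw he
    exact hwe e' he' hwe'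
  · push Not at h
    exact ⟨∅, isOpen_empty, fun w hw hcl => ⟨fun hd => absurd hd (h w hw hcl), fun h => h.elim⟩⟩

end LinearizedSections
end DenseOrbits

/-! ### Iterates and irreducible components -/

section IteratesAndComponents

variable {X : Type*} [TopologicalSpace X]

lemma homeoOrbit_zpow_apply (τ : X ≃ₜ X) (i : ℤ) (x : X) :
    homeoOrbit τ ((τ ^ i) x) = homeoOrbit τ x := by
  have h (i : ℤ) (x : X) : homeoOrbit τ ((τ ^ i) x) ⊆ homeoOrbit τ x := by
    rintro _ ⟨n, rfl⟩
    exact ⟨n + i, by dsimp only; rw [zpow_add]; rfl⟩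
  refine (h i x).antisymm ?_
  have h1 := h (-i) ((τ ^ i) x)
  rwa [← homeo_mul_apply, ← zpow_add, neg_add_cancel] at h1

lemma homeoOrbit_pow_subset (τ : X ≃ₜ X) (m : ℕ) (x : X) :
    homeoOrbit (τ ^ m) x ⊆ homeoOrbit τ x := by
  rintro _ ⟨n, rfl⟩
  exact ⟨m * n, by dsimp only; rw [zpow_mul, zpow_natCast]⟩

lemma homeoOrbit_subset_iUnion_pow (τ : X ≃ₜ X) {m : ℕ} (hm : 1 ≤ m) (x : X) :
    homeoOrbit τ x ⊆ ⋃ i ∈ Finset.range m, (τ ^ i) '' homeoOrbit (τ ^ m) x := by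
  rintro _ ⟨n, rfl⟩
  have hm' : (m : ℤ) ≠ 0 := by omega
  have h1 : 0 ≤ n % m := Int.emod_nonneg _ hm'
  have h2 : n % m < m := Int.emod_lt_of_pos _ (by omega)
  simp only [Set.mem_iUnion]
  refine ⟨(n % m).toNat, Finset.mem_range.mpr (by omega), _, ⟨n / m, rfl⟩, ?_⟩
  rw [← homeo_mul_apply, ← zpow_natCast, ← zpow_natCast, ← zpow_mul, ← zpow_add,
    Int.toNat_of_nonneg h1, Int.emod_add_mul_ediv]

/-- The irreducible components of a subset `Z`, as subsets of the ambient space. -/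
def IsComponentOf (Z W : Set X) : Prop :=
  Maximal (fun W => IsIrreducible W ∧ IsClosed W ∧ W ⊆ Z) W

lemma IsComponentOf.image {τ : X ≃ₜ X} {Z W : Set X} (hZ : τ '' Z = Z) (hW : IsComponentOf Z W) :
    IsComponentOf Z (τ '' W) := by
  refine ⟨⟨hW.1.1.image _ τ.continuous.continuousOn, τ.isClosedMap _ hW.1.2.1, ?_⟩, ?_⟩
  · conv_rhs => rw [← hZ]
    exact Set.image_mono hW.1.2.2
  · rintro W' ⟨h1, h2, h3⟩ h4
    have h5 : τ.symm '' W' ⊆ Z := by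
      rw [← hZ] at h3
      rw [τ.symm.image_eq_preimage_symm]
      intro x hx
      obtain ⟨y, hy, hyx⟩ := h3 hx
      exact τ.injective hyx ▸ hy
    have h6 := hW.2 ⟨h1.image _ τ.symm.continuous.continuousOn, τ.symm.isClosedMap _ h2, h5⟩
      (fun x hx => ⟨τ x, h4 ⟨x, hx, rfl⟩, by simp⟩)
    intro y hy
    exact ⟨τ.symm y, h6 ⟨y, hy, rfl⟩, by simp⟩

lemma exists_finite_components [TopologicalSpace.NoetherianSpace X] {Z : Set X} (hZ : IsClosed Z) :
    {W | IsComponentOf Z W}.Finite ∧ ∀ z ∈ Z, ∃ W, IsComponentOf Z W ∧ z ∈ W := by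
  obtain ⟨S, hS, hcl, hirr, rfl⟩ :=
    TopologicalSpace.NoetherianSpace.exists_finite_set_isClosed_irreducible hZ
  have hsub (W : Set X) (hW : IsIrreducible W) (h : W ⊆ ⋃₀ S) : ∃ t ∈ S, W ⊆ t :=
    isIrreducible_iff_sUnion_isClosed.mp hW hS.toFinset (by simpa using hcl) (by simpa using h)
      |>.imp fun t ht => by simpa using ht
  refine ⟨hS.subset ?_, ?_⟩
  · intro W hW
    obtain ⟨t, ht, hWt⟩ := hsub W hW.1.1 hW.1.2.2
    rwa [hWt.antisymm (hW.2 ⟨hirr t ht, hcl t ht, Set.subset_sUnion_of_mem ht⟩ hWt)]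
  · rintro z ⟨t, ht, hzt⟩
    obtain ⟨W, htW, hW⟩ := hS.exists_le_maximal ht
    refine ⟨W, ⟨⟨hirr W hW.1, hcl W hW.1, Set.subset_sUnion_of_mem hW.1⟩, ?_⟩, htW hzt⟩
    rintro W' ⟨h1, -, h3⟩ h4
    obtain ⟨t', ht', hWt'⟩ := hsub W' h1 h3
    exact hWt'.trans (hW.2 ht' (h4.trans hWt'))

/-- To prove that the closed points with dense orbit in a closed invariant set `Z` form an open set,
one may replace `Z` by an irreducible component and the homeomorphism by an iterate. -/
theorem exists_isOpen_dense_iff_of_components [TopologicalSpace.NoetherianSpace X] (τ : X ≃ₜ X)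
    {n : ℕ} (hn : 1 ≤ n) {Z : Set X} (hZ : IsClosed Z) (hτ : τ '' Z = Z)
    (H : ∀ (W : Set X) (N : ℕ), IsIrreducible W → IsClosed W → (τ ^ (n * N)) '' W = W →
      1 ≤ N → IsComponentOf Z W → ∃ V : Set X, IsOpen V ∧
        ∀ w ∈ W, IsClosed {w} → (closure (homeoOrbit (τ ^ (n * N)) w) = W ↔ w ∈ V)) :
    ∃ V : Set X, IsOpen V ∧ ∀ z ∈ Z, IsClosed {z} → (closure (homeoOrbit τ z) = Z ↔ z ∈ V) := by
  by_cases h : ∃ z₀ ∈ Z, IsClosed {z₀} ∧ closure (homeoOrbit τ z₀) = Z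
  swap
  · push Not at h
    exact ⟨∅, isOpen_empty, fun w hw hcl => ⟨fun hd => absurd hd (h w hw hcl), fun h => h.elim⟩⟩
  obtain ⟨z₀, hz₀, -, hd₀⟩ := h
  obtain ⟨hfin, hcov⟩ := exists_finite_components hZ
  obtain ⟨W, hW, hz₀W⟩ := hcov z₀ hz₀
  have himage (i : ℤ) : IsComponentOf Z ((τ ^ i) '' W) := hW.image (image_zpow_eq hτ i)
  -- Some iterate of `τ` fixes the component `W`, as there are finitely many components.
  obtain ⟨N, hN, hNW⟩ : ∃ N : ℕ, 1 ≤ N ∧ (τ ^ N) '' W = W := by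
    obtain ⟨a, b, hab, h⟩ := hfin.exists_lt_map_eq_of_forall_mem (α := ℕ)
      (f := fun i => (τ ^ i) '' W) fun i => by simpa using himage i
    refine ⟨b - a, by omega, ?_⟩
    apply (Set.image_injective.mpr (τ ^ a).injective)
    rw [Set.image_image]
    rw [h]
    conv_rhs => rw [← Nat.add_sub_cancel' hab.le, pow_add]
    rfl
  have hm : 1 ≤ n * N := Nat.mul_pos hn hN
  have hmW : (τ ^ (n * N)) '' W = W := by
    have h1 := image_zpow_eq hNW n
    rwa [zpow_natCast, ← pow_mul, mul_comm] at h1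
  obtain ⟨V', hV', hiff⟩ := H W N hW.1.1 hW.1.2.1 hmW hN hW
  have hfin' : {W' | IsComponentOf Z W' ∧ W' ≠ W}.Finite := hfin.subset fun _ h => h.1
  -- the complement of the other components: its trace on `Z` is a nonempty open subset of `W`
  set V'' : Set X := (⋃₀ {W' | IsComponentOf Z W' ∧ W' ≠ W})ᶜ with hV''
  have hV''o : IsOpen V'' := by
    rw [hV'', Set.sUnion_eq_biUnion]
    exact (hfin'.isClosed_biUnion fun W' h => h.1.1.2.1).isOpen_compl
  have hV''W : ∀ z ∈ Z, z ∈ V'' → z ∈ W := by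
    intro z hz hzV
    obtain ⟨W', hW', hzW'⟩ := hcov z hz
    by_contra hzW
    exact hzV ⟨W', ⟨hW', fun h => hzW (h ▸ hzW')⟩, hzW'⟩
  have hne : (V'' ∩ Z).Nonempty := by
    by_contra hemp
    have h1 : W ⊆ ⋃₀ {W' | IsComponentOf Z W' ∧ W' ≠ W} := by
      intro x hx
      by_contra hx'
      exact hemp ⟨x, hx', hW.1.2.2 hx⟩
    obtain ⟨t, ht, hWt⟩ := isIrreducible_iff_sUnion_isClosed.mp hW.1.1 hfin'.toFinset
      (fun t ht => ((Set.Finite.mem_toFinset _).mp ht).1.1.2.1) (by simpa using h1)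
    have ht' := (Set.Finite.mem_toFinset _).mp ht
    exact ht'.2 ((hW.2 ht'.1.1 hWt).antisymm hWt)
  have hclosed (i : ℤ) (x : X) (hx : IsClosed {x}) : IsClosed {(τ ^ i) x} := by
    rw [← Set.image_singleton]
    exact (τ ^ i).isClosedMap _ hx
  have hZmem (i : ℤ) (x : X) (hx : x ∈ Z) : (τ ^ i) x ∈ Z := by
    rw [← image_zpow_eq hτ i]
    exact ⟨x, hx, rfl⟩
  refine ⟨⋃ i : ℤ, (τ ^ i) '' (V' ∩ V''),
    isOpen_iUnion fun i => (τ ^ i).isOpenMap _ (hV'.inter hV''o),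
    fun z hz hzcl => ⟨fun hd => ?_, ?_⟩⟩
  · obtain ⟨y, hyV, hyZ⟩ := hne
    rw [← hd] at hyZ
    obtain ⟨_, hwV, ⟨i, rfl⟩⟩ := mem_closure_iff.mp hyZ V'' hV''o hyV
    set w := (τ ^ i) z with hw
    have hwW : w ∈ W := hV''W w (hZmem i z hz) hwV
    have hdw : closure (homeoOrbit τ w) = Z := by rw [hw, homeoOrbit_zpow_apply, hd]
    have hcl : closure (homeoOrbit (τ ^ (n * N)) w) ⊆ W :=
      closure_minimal (homeoOrbit_subset hmW hwW) hW.1.2.1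
    have hcover : W ⊆
        ⋃ j ∈ Finset.range (n * N), (τ ^ j) '' closure (homeoOrbit (τ ^ (n * N)) w) := by
      refine hW.1.2.2.trans ?_
      rw [← hdw]
      refine closure_minimal ((homeoOrbit_subset_iUnion_pow τ hm w).trans ?_)
        (isClosed_biUnion_finset fun j _ => (τ ^ j).isClosedMap _ isClosed_closure)
      exact Set.iUnion₂_mono fun j _ => Set.image_mono subset_closure
    -- `W` is covered by finitely many translates of the closure of the orbit under the iterate
    obtain ⟨j, hj⟩ : ∃ j : ℕ, W ⊆ (τ ^ j) '' closure (homeoOrbit (τ ^ (n * N)) w) := by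
      classical
      obtain ⟨t, ht, hWt⟩ := isIrreducible_iff_sUnion_isClosed.mp hW.1.1
        ((Finset.range (n * N)).image fun j : ℕ => ⇑(τ ^ j) '' closure (homeoOrbit (τ ^ (n * N)) w))
        (by
          intro t ht
          obtain ⟨j, -, rfl⟩ := Finset.mem_image.mp ht
          exact (τ ^ j).isClosedMap _ isClosed_closure)
        (by simpa using hcover)
      obtain ⟨j, -, rfl⟩ := Finset.mem_image.mp ht
      exact ⟨j, hWt⟩
    have hjW : (τ ^ j) '' W ⊆ W :=
      hW.2 (by simpa using (himage j).1) (hj.trans (Set.image_mono hcl))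
    have hdense : closure (homeoOrbit (τ ^ (n * N)) w) = W := by
      refine hcl.antisymm fun x hx => ?_
      obtain ⟨y, hy, hyx⟩ := hj (hjW ⟨x, hx, rfl⟩)
      rwa [← (τ ^ j).injective hyx]
    refine Set.mem_iUnion.mpr ⟨-i, w, ⟨(hiff w hwW (hclosed i z hzcl)).mp hdense, hwV⟩, ?_⟩
    rw [hw, ← homeo_mul_apply, ← zpow_add, neg_add_cancel]
    rfl
  · intro hzV
    obtain ⟨i, w, ⟨hwV', hwV''⟩, rfl⟩ := Set.mem_iUnion.mp hzV
    have hback : (τ ^ (-i)) ((τ ^ i) w) = w := by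
      rw [← homeo_mul_apply, ← zpow_add, neg_add_cancel]
      rfl
    have hwW : w ∈ W := hV''W w (hback ▸ hZmem (-i) _ hz) hwV''
    have hdw := (hiff w hwW (hback ▸ hclosed (-i) _ hzcl)).mpr hwV'
    rw [homeoOrbit_zpow_apply]
    refine (closure_minimal (homeoOrbit_subset hτ (hW.1.2.2 hwW)) hZ).antisymm ?_
    conv_lhs => rw [← hd₀]
    refine closure_minimal (homeoOrbit_subset (image_closure_homeoOrbit τ w) ?_) isClosed_closure
    exact closure_mono (homeoOrbit_pow_subset τ (n * N) w) (hdw ▸ hz₀W)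

end IteratesAndComponents

/-! ### Automorphisms of schemes as homeomorphisms -/

section SchemeOrbits

variable {X : Scheme.{u}}

/-- The homeomorphism of the underlying space induced by an automorphism of a scheme. -/
noncomputable def autHomeo : Aut X →* (X ≃ₜ X) where
  toFun σ := Scheme.homeoOfIso σ
  map_one' := rfl
  map_mul' _ _ := by ext; rfl

@[simp] lemma autHomeo_apply (σ : Aut X) (x : X) : autHomeo σ x = σ.hom x := rfl

lemma orbit_eq_homeoOrbit (σ : Aut X) (x : X) : orbit σ x = homeoOrbit (autHomeo σ) x := by
  simp only [orbit, homeoOrbit, ← map_zpow, autHomeo_apply]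

lemma hasGoodDenseOrbitsOn_of_exists (σ : Aut X) (Z : Set X)
    (h : ∃ V : Set X, IsOpen V ∧ ∀ z ∈ Z, IsClosed {z} →
      (closure (homeoOrbit (autHomeo σ) z) = Z ↔ z ∈ V)) : HasGoodDenseOrbitsOn σ Z := by
  obtain ⟨V, hV, h⟩ := h
  refine ⟨V, hV, ?_⟩
  ext z
  constructor
  · rintro ⟨hz, hd⟩
    rw [orbit_eq_homeoOrbit] at hd
    exact ⟨(h z hz.1 hz.2).mp hd, hz⟩
  · rintro ⟨hzV, hz⟩
    refine ⟨hz, ?_⟩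
    rw [orbit_eq_homeoOrbit]
    exact (h z hz.1 hz.2).mpr hzV

end SchemeOrbits

/-! ### Local equations and sections of Cartier divisors -/

section LocalEquations

variable {X : Scheme.{u}} [IsIntegral X]

lemma stalk_algebraMap_injective (x : X) :
    Function.Injective (algebraMap (X.presheaf.stalk x) X.functionField) :=
  IsFractionRing.injective _ _

lemma exists_open_unit_of_unit_stalk (x : X) (a : (X.presheaf.stalk x)ˣ) :
    ∃ U : X.Opens, x ∈ U ∧ ∀ y ∈ U, ∃ b : (X.presheaf.stalk y)ˣ,
      algebraMap (X.presheaf.stalk y) X.functionField b =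
        algebraMap (X.presheaf.stalk x) X.functionField a := by
  obtain ⟨U, hxU, s, hs⟩ := X.presheaf.exists_germ_eq (a : X.presheaf.stalk x)
  have : Nonempty U := ⟨⟨x, hxU⟩⟩
  refine ⟨X.basicOpen s, (X.mem_basicOpen s x hxU).mpr (hs ▸ a.isUnit), fun y hy => ?_⟩
  have hyU : y ∈ U := X.basicOpen_le s hy
  refine ⟨((X.mem_basicOpen s y hyU).mp hy).unit, ?_⟩
  rw [IsUnit.unit_spec, ← hs, Scheme.algebraMap_germ_eq_germToFunctionField,
    Scheme.algebraMap_germ_eq_germToFunctionField]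

lemma mem_stalkUnits_iff {x : X} {v : (X.functionField)ˣ} :
    v ∈ stalkUnits X x ↔ ∃ a : (X.presheaf.stalk x)ˣ,
      algebraMap (X.presheaf.stalk x) X.functionField a = v := by
  constructor
  · rintro ⟨a, rfl⟩
    exact ⟨a, rfl⟩
  · rintro ⟨a, ha⟩
    exact ⟨a, Units.ext ha⟩

namespace CartierDivisor

/-- `v` is a local equation of `D` at `x`. -/
def IsLocalEquation (D : CartierDivisor X) (x : X) (v : (X.functionField)ˣ) : Prop :=
  D.localClass x = QuotientGroup.mk v

lemma exists_isLocalEquation (D : CartierDivisor X) (x : X) : ∃ v, D.IsLocalEquation x v := by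
  obtain ⟨v, hv⟩ := QuotientGroup.mk_surjective (D.localClass x)
  exact ⟨v, hv.symm⟩

lemma exists_open_isLocalEquation (D : CartierDivisor X) (x : X) :
    ∃ U : X.Opens, x ∈ U ∧ ∃ v, ∀ y ∈ U, D.IsLocalEquation y v :=
  (Additive.toMul D).2 x

lemma isLocalEquation_iff {D : CartierDivisor X} {x : X} {v w : (X.functionField)ˣ}
    (hv : D.IsLocalEquation x v) : D.IsLocalEquation x w ↔
      ∃ a : (X.presheaf.stalk x)ˣ,
        (w : X.functionField) = v * algebraMap (X.presheaf.stalk x) X.functionField a := by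
  unfold IsLocalEquation at *
  rw [hv, QuotientGroup.eq, mem_stalkUnits_iff]
  refine exists_congr fun a => ?_
  rw [Units.val_mul, Units.val_inv_eq_inv_val, eq_inv_mul_iff_mul_eq₀ v.ne_zero]
  exact eq_comm

lemma isLocalEquation_zero (x : X) : (0 : CartierDivisor X).IsLocalEquation x 1 := rfl

lemma IsLocalEquation.add {D E : CartierDivisor X} {x : X} {v w : (X.functionField)ˣ}
    (hv : D.IsLocalEquation x v) (hw : E.IsLocalEquation x w) :
    (D + E).IsLocalEquation x (v * w) := by
  change D.localClass x * E.localClass x = _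
  rw [hv, hw]
  rfl

lemma IsLocalEquation.nsmul {D : CartierDivisor X} {x : X} {v : (X.functionField)ˣ}
    (hv : D.IsLocalEquation x v) (n : ℕ) : (n • D).IsLocalEquation x (v ^ n) := by
  induction n with
  | zero => rw [zero_nsmul, pow_zero]; exact isLocalEquation_zero x
  | succ n ih => rw [succ_nsmul, pow_succ]; exact ih.add hv

lemma mem_globalSections_iff {D : CartierDivisor X} {f : X.functionField} :
    f ∈ D.globalSections ↔ ∀ x, ∃ v, D.IsLocalEquation x v ∧
      ∃ a, algebraMap (X.presheaf.stalk x) X.functionField a = f * v := by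
  constructor
  · intro h x
    obtain ⟨v, hv⟩ := D.exists_isLocalEquation x
    exact ⟨v, hv, h x v hv⟩
  · intro h x w hw
    obtain ⟨v, hv, a, ha⟩ := h x
    obtain ⟨b, hb⟩ := (isLocalEquation_iff hv).mp hw
    exact ⟨a * b, by rw [hb, map_mul, ha, mul_assoc]⟩

lemma exists_stalk_of_mem_globalSections {D : CartierDivisor X} {f : X.functionField}
    (hf : f ∈ D.globalSections) {x : X} {v : (X.functionField)ˣ} (hv : D.IsLocalEquation x v) :
    ∃ a, algebraMap (X.presheaf.stalk x) X.functionField a = f * v := hf x v hv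

lemma mem_nonvanishingLocus_iff {D : CartierDivisor X} {f : X.functionField} {x : X}
    {v : (X.functionField)ˣ} (hv : D.IsLocalEquation x v) {a : X.presheaf.stalk x}
    (ha : algebraMap (X.presheaf.stalk x) X.functionField a = f * v) :
    x ∈ D.nonvanishingLocus f ↔ IsUnit a := by
  constructor
  · rintro ⟨w, hw, b, hb⟩
    obtain ⟨c, hc⟩ := (isLocalEquation_iff hv).mp hw
    have h : a * c = b := by
      apply stalk_algebraMap_injective x
      rw [map_mul, ha, mul_assoc, ← hc, hb]
    exact isUnit_of_mul_isUnit_left (h ▸ b.isUnit)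
  · rintro ⟨b, rfl⟩
    exact ⟨v, hv, b, ha.symm⟩

lemma isOpen_nonvanishingLocus (D : CartierDivisor X) (f : X.functionField) :
    IsOpen (D.nonvanishingLocus f) := by
  rw [isOpen_iff_forall_mem_open]
  intro x hx
  obtain ⟨U, hxU, v, hv⟩ := D.exists_open_isLocalEquation x
  obtain ⟨w, hw, a, ha⟩ := hx
  obtain ⟨c, hc⟩ := (isLocalEquation_iff (hv x hxU)).mp hw
  obtain ⟨U', hxU', hU'⟩ := exists_open_unit_of_unit_stalk x (a * c⁻¹)
  refine ⟨(U ⊓ U' : X.Opens), fun y hy => ?_, (U ⊓ U').isOpen, ⟨hxU, hxU'⟩⟩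
  obtain ⟨b, hb⟩ := hU' y hy.2
  refine ⟨v, hv y hy.1, b, ?_⟩
  have hc1 : algebraMap (X.presheaf.stalk x) X.functionField c *
      algebraMap (X.presheaf.stalk x) X.functionField (c⁻¹ : (X.presheaf.stalk x)ˣ) = 1 := by
    rw [← map_mul, Units.mul_inv, map_one]
  rw [hb, Units.val_mul, map_mul, ← ha, hc, mul_assoc, mul_assoc, hc1, mul_one]

lemma mul_mem_globalSections {D E : CartierDivisor X} {f g : X.functionField}
    (hf : f ∈ D.globalSections) (hg : g ∈ E.globalSections) :
    f * g ∈ (D + E).globalSections := by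
  rw [mem_globalSections_iff]
  intro x
  obtain ⟨v, hv, a, ha⟩ := mem_globalSections_iff.mp hf x
  obtain ⟨w, hw, b, hb⟩ := mem_globalSections_iff.mp hg x
  exact ⟨v * w, hv.add hw, a * b, by rw [map_mul, ha, hb, Units.val_mul]; ring⟩

lemma nonvanishingLocus_mul {D E : CartierDivisor X} {f g : X.functionField}
    (hf : f ∈ D.globalSections) (hg : g ∈ E.globalSections) :
    (D + E).nonvanishingLocus (f * g) = D.nonvanishingLocus f ∩ E.nonvanishingLocus g := by
  ext x
  obtain ⟨v, hv, a, ha⟩ := mem_globalSections_iff.mp hf x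
  obtain ⟨w, hw, b, hb⟩ := mem_globalSections_iff.mp hg x
  rw [Set.mem_inter_iff, mem_nonvanishingLocus_iff hv ha, mem_nonvanishingLocus_iff hw hb,
    mem_nonvanishingLocus_iff (hv.add hw) (a := a * b)
      (by rw [map_mul, ha, hb, Units.val_mul]; ring), IsUnit.mul_iff]

end CartierDivisor

end LocalEquations

/-! ### Constants in local rings -/

section Constants

variable {X : Scheme.{u}} {k : Type u} [Field k] (p : X ⟶ Spec (.of k))

/-- The structure map `k → 𝒪_{X,x}` of a local ring of a `k`-scheme. -/
noncomputable def stalkConstants (x : X) : k →+* X.presheaf.stalk x :=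
  ((X.presheaf.germ ⊤ x trivial).hom.comp p.appTop.hom).comp (Scheme.ΓSpecIso (.of k)).inv.hom

lemma algebraMap_stalkConstants [IsIntegral X] (x : X) (c : k) :
    algebraMap (X.presheaf.stalk x) X.functionField (stalkConstants p x c) = constants p c := by
  have : Nonempty (⊤ : X.Opens) := ⟨⟨x, trivial⟩⟩
  exact Scheme.algebraMap_germ_eq_germToFunctionField X (U := ⊤) (x := x) trivial _

/-- The residue field at a closed point is `k`, in the form: every element of the local ring differs
from a constant by a non-unit. -/
lemma exists_not_isUnit_sub_stalkConstants [IsAlgClosed k] [LocallyOfFiniteType p] {x : X}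
    (hx : IsClosed {x}) (a : X.presheaf.stalk x) :
    ∃ c : k, ¬ IsUnit (a - stalkConstants p x c) := by
  obtain ⟨i, hi, rfl⟩ : ∃ i : Spec (.of k) ⟶ X, i ≫ p = 𝟙 _ ∧
      i (IsLocalRing.closedPoint k) = x :=
    ⟨pointOfClosedPoint p x hx, pointOfClosedPoint_comp p x hx, pointOfClosedPoint_apply p x hx _⟩
  -- evaluation at the rational point `i`
  let ev := Scheme.stalkClosedPointTo (R := .of k) i
  have hev (c : k) : ev.hom (stalkConstants p (i (IsLocalRing.closedPoint k)) c) = c := by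
    have h1 := Scheme.germ_stalkClosedPointTo (R := .of k) i ⊤ trivial
    have h2 : (Scheme.ΓSpecIso (.of k)).inv ≫ p.appTop ≫ X.presheaf.germ ⊤ _ trivial ≫ ev =
        𝟙 _ := by
      have h3 : p.appTop ≫ i.app ⊤ = (Spec (.of k)).presheaf.map (𝟙 _) := by
        have h4 := congr_arg Scheme.Hom.appTop hi
        simpa using h4
      rw [h1, reassoc_of% h3]
      change _ ≫ _ ≫ (Spec (.of k)).presheaf.map (𝟙 _) ≫ _ = _
      simp
    exact congrArg (fun φ => φ.hom c) h2
  refine ⟨ev.hom a, fun h => ?_⟩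
  have h1 := h.map ev.hom
  rw [map_sub, hev, sub_self] at h1
  exact not_isUnit_zero h1

end Constants

/-! ### Finite-dimensionality of spaces of sections -/

section FiniteDimensionality

variable {X : Scheme.{u}} [IsIntegral X] {k : Type u} [Field k] (p : X ⟶ Spec (.of k))

lemma essFiniteType_functionField [LocallyOfFiniteType p] [Algebra k X.functionField]
    (hp : algebraMap k X.functionField = constants p) :
    Algebra.EssFiniteType k X.functionField := by
  obtain ⟨_, ⟨U, hU, rfl⟩, hxU, -⟩ := X.isBasis_affineOpens.exists_subset_of_mem_open
    (Set.mem_univ (genericPoint X)) isOpen_univ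
  have : Nonempty U := ⟨⟨_, hxU⟩⟩
  have hft : (p.appLE ⊤ U le_top).hom.FiniteType :=
    LocallyOfFiniteType.finiteType_appLE p (isAffineOpen_top _) hU le_top
  let ψ : k →+* Γ(X, U) := (p.appLE ⊤ U le_top).hom.comp (Scheme.ΓSpecIso (.of k)).inv.hom
  let : Algebra k Γ(X, U) := ψ.toAlgebra
  have : Algebra.FiniteType k Γ(X, U) := by
    have h : ψ.FiniteType := hft.comp (RingHom.FiniteType.of_surjective _
      (ConcreteCategory.bijective_of_isIso (Scheme.ΓSpecIso (.of k)).inv).2)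
    exact h
  have : IsScalarTower k Γ(X, U) X.functionField := IsScalarTower.of_algebraMap_eq fun c => by
    rw [hp]
    change (X.presheaf.germ ⊤ (genericPoint X) trivial) (p.appTop _) =
      X.presheaf.germ U _ _ (p.appLE ⊤ U le_top _)
    have h : p.appLE ⊤ U le_top = p.appTop ≫ X.presheaf.map (homOfLE le_top).op := by
      rw [Scheme.Hom.appTop, Scheme.Hom.app_eq_appLE]
      exact (Scheme.Hom.appLE_map p (V := p ⁻¹ᵁ ⊤) (V' := U) le_rfl (homOfLE le_top).op).symm
    rw [h, CommRingCat.comp_apply, X.presheaf.germ_res_apply]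
  have : IsFractionRing Γ(X, U) X.functionField :=
    functionField_isFractionRing_of_isAffineOpen X U hU
  have : Algebra.EssFiniteType Γ(X, U) X.functionField :=
    Algebra.EssFiniteType.of_isLocalization X.functionField (nonZeroDivisors Γ(X, U))
  exact Algebra.EssFiniteType.comp k Γ(X, U) X.functionField

lemma fromSpecStalk_genericPoint_comp :
    X.fromSpecStalk (genericPoint X) ≫ p =
      Spec.map (CommRingCat.ofHom (constants p) : .of k ⟶ X.functionField) := by
  have h1 : p = X.toSpecΓ ≫ Spec.map p.appTop ≫ Spec.map (Scheme.ΓSpecIso (.of k)).inv := by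
    rw [← Scheme.toSpecΓ_naturality_assoc]
    simp
  conv_lhs => rw [h1]
  rw [Scheme.fromSpecStalk_toSpecΓ_assoc, ← Spec.map_comp, ← Spec.map_comp]
  rfl

/-- The valuative criterion: every valuation ring of `K(X) / k` contains a local ring of a proper
`k`-scheme `X`. -/
lemma exists_stalk_le_valuationSubring [IsProper p] (R : ValuationSubring X.functionField)
    (hR : ∀ c : k, constants p c ∈ R) :
    ∃ x : X, ∀ a, algebraMap (X.presheaf.stalk x) X.functionField a ∈ R := by
  let ψ : k →+* R := (constants p).codRestrict R.toSubring hR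
  have hsq : CommSq (X.fromSpecStalk (genericPoint X))
      (Spec.map (CommRingCat.ofHom (algebraMap R X.functionField))) p
      (Spec.map (CommRingCat.ofHom ψ)) := ⟨(fromSpecStalk_genericPoint_comp p).trans
    (Spec.map_comp (CommRingCat.ofHom ψ) (CommRingCat.ofHom (algebraMap R X.functionField)))⟩
  have hE : ValuativeCriterion.Existence p := by
    have h := UniversallyClosed.eq_valuativeCriterion
    have h2 : UniversallyClosed p := inferInstance
    rw [h] at h2
    exact h2.1
  obtain ⟨⟨l, hl, -⟩⟩ :=
    (hE { R := R, K := X.functionField, i₁ := _, i₂ := _, commSq := hsq }).exists_lift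
  let φ := Scheme.stalkClosedPointTo (R := .of R) l
  refine ⟨l (IsLocalRing.closedPoint R), fun a => ?_⟩
  have h1 : φ ≫ CommRingCat.ofHom (algebraMap R X.functionField) =
      X.presheaf.stalkSpecializes ((genericPoint_spec X).specializes trivial) := by
    apply Spec.map_injective
    rw [← cancel_mono (X.fromSpecStalk _), Scheme.SpecMap_stalkSpecializes_fromSpecStalk,
      Spec.map_comp, Category.assoc, Scheme.Spec_stalkClosedPointTo_fromSpecStalk]
    exact hl
  have h2 : algebraMap R X.functionField (φ.hom a) =
      algebraMap (X.presheaf.stalk (l (IsLocalRing.closedPoint R))) X.functionField a :=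
    congrArg (fun ψ => ψ.hom a) h1
  rw [← h2]
  exact (φ.hom a).2

variable [Algebra k X.functionField]

/-- The `k`-vector space `H⁰(X, 𝒪_X(D))`. -/
noncomputable def sectionSpace (hp : algebraMap k X.functionField = constants p)
    (D : CartierDivisor X) : Submodule k X.functionField where
  carrier := D.globalSections
  zero_mem' x v _ := ⟨0, by simp⟩
  add_mem' {f g} hf hg x v hv := by
    obtain ⟨a, ha⟩ := hf x v hv
    obtain ⟨b, hb⟩ := hg x v hv
    exact ⟨a + b, by rw [map_add, ha, hb, add_mul]⟩
  smul_mem' c f hf x v hv := by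
    obtain ⟨a, ha⟩ := hf x v hv
    exact ⟨stalkConstants p x c * a, by
      rw [map_mul, ha, algebraMap_stalkConstants, Algebra.smul_def, hp, mul_assoc]⟩

variable {p} in
lemma mem_sectionSpace {hp : algebraMap k X.functionField = constants p} {D : CartierDivisor X}
    {f : X.functionField} : f ∈ sectionSpace p hp D ↔ f ∈ D.globalSections := Iff.rfl

/-- Serre finiteness for `H⁰` of a divisor on a proper integral scheme. A valuation ring `R` of
`K(X) / k` contains the local ring at a point of one of finitely many open sets on which `D` has a
local equation `v`, so that `H⁰(X, 𝒪_X(D)) ⊆ R v⁻¹`. -/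
theorem finiteDimensional_sectionSpace [PerfectField k] [IsProper p]
    (hp : algebraMap k X.functionField = constants p) (D : CartierDivisor X) :
    FiniteDimensional k (sectionSpace p hp D) := by
  classical
  have := essFiniteType_functionField p hp
  have : CompactSpace X := QuasiCompact.compactSpace_of_compactSpace p
  choose U hxU v hv using D.exists_open_isLocalEquation
  obtain ⟨t, ht⟩ := isCompact_univ.elim_finite_subcover (fun x => (U x : Set X))
    (fun x => (U x).isOpen) (fun x _ => Set.mem_iUnion.mpr ⟨x, hxU x⟩)
  refine finiteDimensional_of_forall_valuationSubring
    (t.image fun x => ((v x)⁻¹ : (X.functionField)ˣ).val) _ fun h hh R hR => ?_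
  obtain ⟨x, hx⟩ := exists_stalk_le_valuationSubring p R fun c => hp ▸ hR c
  obtain ⟨y, hy, hxy⟩ := Set.mem_iUnion₂.mp (ht (Set.mem_univ x))
  obtain ⟨a, ha⟩ := hh x (v y) (hv y x hxy)
  refine ⟨_, Finset.mem_image_of_mem _ hy, h * v y, ha ▸ hx a, ?_⟩
  rw [mul_assoc, Units.mul_inv, mul_one]

end FiniteDimensionality

/-! ### The linearization attached to a linear equivalence -/

section Linearization

variable {X : Scheme.{u}} {k : Type u} [Field k] {p : X ⟶ Spec (.of k)}

lemma stalkMap_stalkConstants {t : X ⟶ X} (ht : t ≫ p = p) (x : X) (c : k) :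
    t.stalkMap x (stalkConstants p (t x) c) = stalkConstants p x c := by
  have h1 : p.appTop ≫ X.presheaf.germ ⊤ (t x) trivial ≫ t.stalkMap x =
      p.appTop ≫ X.presheaf.germ ⊤ x trivial := by
    have h3 : X.presheaf.germ ⊤ (t x) trivial ≫ t.stalkMap x =
        t.appTop ≫ X.presheaf.germ ⊤ x trivial := Scheme.Hom.germ_stalkMap t ⊤ x trivial
    rw [h3]
    have h2 : p.appTop ≫ t.appTop = p.appTop := by
      rw [← Scheme.Hom.comp_appTop, ht]
    exact (Category.assoc _ _ _).symm.trans (congrArg (· ≫ X.presheaf.germ ⊤ x trivial) h2)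
  exact congrArg (fun φ => φ.hom ((Scheme.ΓSpecIso (.of k)).inv.hom c)) h1

variable [IsIntegral X]

lemma functionFieldMap_constants {t : X ⟶ X} [IsDominant t] (ht : t ≫ p = p) (c : k) :
    functionFieldMap t (constants p c) = constants p c := by
  have x : X := genericPoint X
  conv_lhs => rw [← algebraMap_stalkConstants p (t x)]
  rw [functionFieldMap_algebraMap, stalkMap_stalkConstants ht, algebraMap_stalkConstants]

/-- If `v` is a local equation of `D` at `τ x`, then `(v ∘ τ) f⁻¹` is one at `x`. -/
lemma CartierDivisor.IsLocalEquation.of_pullback_eq {D : CartierDivisor X} {τ : Aut X}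
    {f : (X.functionField)ˣ} (hD : D.pullback τ.hom = D + CartierDivisor.principal f) {x : X}
    {v : (X.functionField)ˣ} (hv : D.IsLocalEquation (τ.hom x) v) :
    D.IsLocalEquation x (Units.map (functionFieldMap τ.hom).toMonoidHom v * f⁻¹) := by
  have h1 : (D.pullback τ.hom).localClass x =
      QuotientGroup.mk (Units.map (functionFieldMap τ.hom).toMonoidHom v) := by
    change QuotientGroup.map _ _ _ (stalkUnits_le_comap τ.hom x) (D.localClass (τ.hom x)) = _
    rw [hv]
    rfl
  rw [hD] at h1
  change D.localClass x * QuotientGroup.mk f = _ at h1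
  unfold IsLocalEquation
  rw [eq_mul_inv_of_mul_eq h1]
  rfl

variable [Algebra k X.functionField]

/-- The map `h ↦ (h ∘ τ) f ^ r` of `K(X)`, which preserves `H⁰(X, rD)` if `τ^* D = D + div f`. -/
noncomputable def linearization (hp : algebraMap k X.functionField = constants p) {τ : Aut X}
    (hτ : τ.hom ≫ p = p) (f : (X.functionField)ˣ) (r : ℕ) :
    X.functionField →ₗ[k] X.functionField where
  toFun h := functionFieldMap τ.hom h * (f : X.functionField) ^ r
  map_add' a b := by rw [map_add, add_mul]
  map_smul' c a := by
    rw [Algebra.smul_def, map_mul, hp, functionFieldMap_constants hτ, RingHom.id_apply,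
      Algebra.smul_def, hp, mul_assoc]

/-- The local expressions of a section `h` at `τ x` and of its image under the linearization at `x`
correspond under the map of local rings. -/
lemma exists_stalk_linearization (hp : algebraMap k X.functionField = constants p) {τ : Aut X}
    (hτ : τ.hom ≫ p = p) {D : CartierDivisor X} {f : (X.functionField)ˣ}
    (hD : D.pullback τ.hom = D + CartierDivisor.principal f) (r : ℕ) {h : X.functionField}
    (hh : h ∈ (r • D).globalSections) (x : X) :
    ∃ v w, (r • D).IsLocalEquation (τ.hom x) v ∧ (r • D).IsLocalEquation x w ∧
      ∃ a, algebraMap (X.presheaf.stalk (τ.hom x)) X.functionField a = h * v ∧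
        algebraMap (X.presheaf.stalk x) X.functionField (τ.hom.stalkMap x a) =
          linearization hp hτ f r h * w := by
  obtain ⟨v, hv⟩ := D.exists_isLocalEquation (τ.hom x)
  obtain ⟨a, ha⟩ := CartierDivisor.exists_stalk_of_mem_globalSections hh (hv.nsmul r)
  refine ⟨_, _, hv.nsmul r, (CartierDivisor.IsLocalEquation.of_pullback_eq hD hv).nsmul r, a, ha,
    ?_⟩
  rw [← functionFieldMap_algebraMap, ha, map_mul, Units.val_pow_eq_pow_val,
    Units.val_pow_eq_pow_val, Units.val_mul, Units.val_inv_eq_inv_val, map_pow, mul_pow, inv_pow]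
  change _ = functionFieldMap τ.hom h * (f : X.functionField) ^ r * _
  have hf : (f : X.functionField) ^ r ≠ 0 := pow_ne_zero _ f.ne_zero
  change _ = _ * _ * (functionFieldMap τ.hom v ^ r * _)
  field_simp

/-- The sections of the multiples of a divisor `D` on a proper integral scheme, with the
linearization of an automorphism `τ` afforded by a rational function `f` such that
`τ^* D = D + div f`. -/
noncomputable def linearizedSections [IsAlgClosed k] [IsProper p]
    (hp : algebraMap k X.functionField = constants p) {τ : Aut X} (hτ : τ.hom ≫ p = p)
    (D : CartierDivisor X) (f : (X.functionField)ˣ)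
    (hD : D.pullback τ.hom = D + CartierDivisor.principal f) :
    LinearizedSections k X.functionField (autHomeo τ) where
  sec r := sectionSpace p hp (r • D)
  finiteDimensional_sec r := finiteDimensional_sectionSpace p hp _
  one_mem := by
    rw [mem_sectionSpace, zero_nsmul, CartierDivisor.mem_globalSections_iff]
    exact fun x => ⟨1, CartierDivisor.isLocalEquation_zero x, 1, by simp⟩
  mul_mem {r s a b} ha hb := by
    rw [mem_sectionSpace, add_nsmul]
    exact CartierDivisor.mul_mem_globalSections ha hb
  zero r a := ((r • D).nonvanishingLocus a)ᶜ
  isClosed_zero {r a} _ := (CartierDivisor.isOpen_nonvanishingLocus _ _).isClosed_compl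
  zero_zero r := by
    rw [Set.compl_univ_iff, Set.eq_empty_iff_forall_notMem]
    intro x hx
    obtain ⟨v, hv⟩ := (r • D).exists_isLocalEquation x
    rw [CartierDivisor.mem_nonvanishingLocus_iff hv (a := 0) (by simp)] at hx
    exact not_isUnit_zero hx
  zero_one := by
    rw [Set.compl_empty_iff, Set.eq_univ_iff_forall, zero_nsmul]
    intro x
    rw [CartierDivisor.mem_nonvanishingLocus_iff (CartierDivisor.isLocalEquation_zero x) (a := 1)
      (by simp)]
    exact isUnit_one
  zero_mul {r s a b} ha hb := by
    rw [add_nsmul, CartierDivisor.nonvanishingLocus_mul ha hb, Set.compl_inter]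
  zero_add {r a b} ha hb := by
    rintro x ⟨hxa, hxb⟩ hx
    obtain ⟨v, hv, a', ha'⟩ := CartierDivisor.mem_globalSections_iff.mp ha x
    obtain ⟨b', hb'⟩ := CartierDivisor.exists_stalk_of_mem_globalSections hb hv
    rw [Set.mem_compl_iff, CartierDivisor.mem_nonvanishingLocus_iff hv ha'] at hxa
    rw [Set.mem_compl_iff, CartierDivisor.mem_nonvanishingLocus_iff hv hb'] at hxb
    rw [CartierDivisor.mem_nonvanishingLocus_iff hv (a := a' + b')
      (by rw [map_add, ha', hb', add_mul])] at hx
    exact (IsLocalRing.isUnit_or_isUnit_of_isUnit_add hx).elim hxa hxb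
  zero_smul {r a} c ha := by
    intro x hxa hx
    obtain ⟨v, hv, a', ha'⟩ := CartierDivisor.mem_globalSections_iff.mp ha x
    rw [Set.mem_compl_iff, CartierDivisor.mem_nonvanishingLocus_iff hv ha'] at hxa
    rw [CartierDivisor.mem_nonvanishingLocus_iff hv (a := stalkConstants p x c * a')
      (by rw [map_mul, ha', algebraMap_stalkConstants, Algebra.smul_def, hp, mul_assoc])] at hx
    exact hxa (isUnit_of_mul_isUnit_right hx)
  exists_mem_zero_sub {r a b x} hx ha hb hxb := by
    obtain ⟨v, hv, a', ha'⟩ := CartierDivisor.mem_globalSections_iff.mp ha x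
    obtain ⟨b', hb'⟩ := CartierDivisor.exists_stalk_of_mem_globalSections hb hv
    rw [Set.notMem_compl_iff, CartierDivisor.mem_nonvanishingLocus_iff hv hb'] at hxb
    obtain ⟨u, rfl⟩ := hxb
    obtain ⟨c, hc⟩ := exists_not_isUnit_sub_stalkConstants p hx (a' * (u⁻¹ : (X.presheaf.stalk x)ˣ))
    refine ⟨c, fun hmem => hc ?_⟩
    rw [CartierDivisor.mem_nonvanishingLocus_iff hv (a := a' - stalkConstants p x c * u)
      (by rw [map_sub, map_mul, ha', hb', algebraMap_stalkConstants, Algebra.smul_def, hp, sub_mul,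
        mul_assoc])] at hmem
    have h1 := hmem.mul (u⁻¹).isUnit
    rwa [sub_mul, mul_assoc (stalkConstants p x c), Units.mul_inv, mul_one] at h1
  φ := linearization hp hτ f
  φ_mem {r a} ha := by
    rw [mem_sectionSpace, CartierDivisor.mem_globalSections_iff]
    intro x
    obtain ⟨v, w, -, hw, b, -, hb⟩ := exists_stalk_linearization hp hτ hD r ha x
    exact ⟨w, hw, _, hb⟩
  φ_one := by
    change functionFieldMap τ.hom 1 * _ = _
    rw [map_one, pow_zero, mul_one]
  φ_mul {r s} a b := by
    change functionFieldMap τ.hom (a * b) * _ = functionFieldMap τ.hom a * _ *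
      (functionFieldMap τ.hom b * _)
    rw [map_mul, pow_add]
    ring
  zero_φ {r a} ha := by
    rw [Set.preimage_compl]
    congr 1
    ext x
    obtain ⟨v, w, hv, hw, b, hb, hb'⟩ := exists_stalk_linearization hp hτ hD r ha x
    rw [CartierDivisor.mem_nonvanishingLocus_iff hw hb', Set.mem_preimage, autHomeo_apply,
      CartierDivisor.mem_nonvanishingLocus_iff hv hb]
    exact isUnit_map_iff (τ.hom.stalkMap x).hom b

end Linearization

/-! ### Sections of ample divisors -/

section Ample

variable {X : Scheme.{u}} [IsIntegral X]

lemma germToFunctionField_res {U V : X.Opens} [Nonempty U] [Nonempty V] (h : V ≤ U) (s : Γ(X, U)) :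
    X.germToFunctionField V (X.presheaf.map (homOfLE h).op s) = X.germToFunctionField U s :=
  X.presheaf.germ_res_apply (homOfLE h) _ _ s

namespace CartierDivisor

/-- Near any point, a function `s` regular on `X_f` becomes a section of `𝒪_X(ND)` after
multiplication by `f ^ N`, for all large `N`. -/
lemma exists_open_mul_pow {D : CartierDivisor X} {f : X.functionField} (hf : f ∈ D.globalSections)
    {U : X.Opens} [Nonempty U] (hU : (U : Set X) = D.nonvanishingLocus f) (s : Γ(X, U)) (x : X) :
    ∃ A : X.Opens, x ∈ A ∧ ∃ n : ℕ, ∀ N, n ≤ N → ∀ y ∈ A, ∃ v, (N • D).IsLocalEquation y v ∧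
      ∃ a, algebraMap (X.presheaf.stalk y) X.functionField a =
        X.germToFunctionField U s * f ^ N * v := by
  obtain ⟨O, hxO, v, hv⟩ := D.exists_open_isLocalEquation x
  obtain ⟨a, ha⟩ := exists_stalk_of_mem_globalSections hf (hv x hxO)
  obtain ⟨B, hxB, t, rfl⟩ := X.presheaf.exists_germ_eq a
  obtain ⟨_, ⟨A, hA, rfl⟩, hxA, hAle⟩ := X.isBasis_affineOpens.exists_subset_of_mem_open
    (show x ∈ ((O ⊓ B : X.Opens) : Set X) from ⟨hxO, hxB⟩) (O ⊓ B).isOpen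
  have hAB : A ≤ B := fun y hy => (hAle hy).2
  have : Nonempty A := ⟨⟨x, hxA⟩⟩
  have : Nonempty B := ⟨⟨x, hxB⟩⟩
  let t' : Γ(X, A) := X.presheaf.map (homOfLE hAB).op t
  have ht' : X.germToFunctionField A t' = f * v := by
    rw [germToFunctionField_res hAB, ← ha, Scheme.algebraMap_germ_eq_germToFunctionField]
  -- on `A` the set `X_f` is the basic open set of `t'`
  have hbasic (y : X) (hy : y ∈ A) : y ∈ X.basicOpen t' ↔ y ∈ U := by
    rw [X.mem_basicOpen t' y hy, ← SetLike.mem_coe, hU,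
      mem_nonvanishingLocus_iff (hv y (hAle hy).1)
        ((Scheme.algebraMap_germ_eq_germToFunctionField X hy t').trans ht')]
  have hle : X.basicOpen t' ≤ U := fun y hy => (hbasic y (X.basicOpen_le _ hy)).mp hy
  have hne : Nonempty (X.basicOpen t') := by
    have hgen (W : X.Opens) [h : Nonempty W] : genericPoint X ∈ W :=
      ((genericPoint_spec X).mem_open_set_iff W.isOpen).mpr (by simpa using h)
    exact ⟨⟨_, (hbasic _ (hgen A)).mpr (hgen U)⟩⟩
  obtain ⟨n, b, hb⟩ := exists_eq_pow_mul_of_isAffineOpen X A hA t'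
    (X.presheaf.map (homOfLE hle).op s)
  have hb' : X.germToFunctionField A b = (f * v) ^ n * X.germToFunctionField U s := by
    have h := congrArg (X.germToFunctionField (X.basicOpen t')) hb
    rw [map_mul, map_pow, germToFunctionField_res hle] at h
    exact ((germToFunctionField_res (X.basicOpen_le t') b).symm.trans h).trans
      (by rw [← ht']; congr 2; exact germToFunctionField_res (X.basicOpen_le t') t')
  refine ⟨A, hxA, n, fun N hN y hy => ⟨v ^ N, (hv y (hAle hy).1).nsmul N,
    X.presheaf.germ A y hy (b * t' ^ (N - n)), ?_⟩⟩
  rw [Scheme.algebraMap_germ_eq_germToFunctionField, map_mul, map_pow, hb', ht',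
    Units.val_pow_eq_pow_val, mul_assoc, mul_comm _ (_ ^ (N - n)), ← mul_assoc, ← pow_add,
    Nat.add_sub_cancel' hN, mul_pow]
  ring

lemma exists_mul_pow_mem_globalSections [CompactSpace X] {D : CartierDivisor X}
    {f : X.functionField} (hf : f ∈ D.globalSections) {U : X.Opens} [Nonempty U]
    (hU : (U : Set X) = D.nonvanishingLocus f) (s : Γ(X, U)) :
    ∃ n : ℕ, X.germToFunctionField U s * f ^ n ∈ (n • D).globalSections := by
  choose A hxA n h using exists_open_mul_pow hf hU s
  obtain ⟨t, ht⟩ := isCompact_univ.elim_finite_subcover (fun x => (A x : Set X))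
    (fun x => (A x).isOpen) (fun x _ => Set.mem_iUnion.mpr ⟨x, hxA x⟩)
  refine ⟨t.sup n, mem_globalSections_iff.mpr fun y => ?_⟩
  obtain ⟨x, hx, hy⟩ := Set.mem_iUnion₂.mp (ht (Set.mem_univ y))
  exact h x _ (Finset.le_sup hx) y hy

/-- Sections of multiples of an ample divisor separate points from closed sets. -/
lemma IsAmple.exists_section {D : CartierDivisor X} (hD : D.IsAmple) {Y : Set X}
    (hY : IsClosed Y) {w : X} (hw : w ∉ Y) :
    ∃ r : ℕ, ∃ a ∈ (r • D).globalSections,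
      Y ⊆ ((r • D).nonvanishingLocus a)ᶜ ∧ w ∈ (r • D).nonvanishingLocus a := by
  have := hD.1
  obtain ⟨m, -, f, hf, U, hwU, hU, hUf⟩ := hD.2 w
  have : Nonempty U := ⟨⟨w, hwU⟩⟩
  obtain ⟨s, hs, hws⟩ := hU.exists_basicOpen_le (V := ⟨Yᶜ, hY.isOpen_compl⟩) ⟨w, hw⟩ hwU
  obtain ⟨n, hn⟩ := exists_mul_pow_mem_globalSections hf hUf s
  -- the extra factor `f` makes the section vanish outside `U`
  have key (y : X) : y ∈ ((m * (n + 1)) • D).nonvanishingLocus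
      (X.germToFunctionField U s * f ^ n * f) ↔ y ∈ X.basicOpen s := by
    rw [mul_nsmul, succ_nsmul, nonvanishingLocus_mul hn hf, Set.mem_inter_iff, ← hUf]
    constructor
    · rintro ⟨h1, h2 : y ∈ U⟩
      obtain ⟨v, hv⟩ := (m • D).exists_isLocalEquation y
      obtain ⟨c, hc⟩ := exists_stalk_of_mem_globalSections hf hv
      rw [mem_nonvanishingLocus_iff (hv.nsmul n) (a := X.presheaf.germ U y h2 s * c ^ n)] at h1
      · exact (X.mem_basicOpen s y h2).mpr (isUnit_of_mul_isUnit_left h1)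
      · rw [map_mul, map_pow, hc, Scheme.algebraMap_germ_eq_germToFunctionField,
          Units.val_pow_eq_pow_val]
        ring
    · intro h
      have h2 : y ∈ U := X.basicOpen_le s h
      refine ⟨?_, h2⟩
      obtain ⟨v, hv⟩ := (m • D).exists_isLocalEquation y
      obtain ⟨c, hc⟩ := exists_stalk_of_mem_globalSections hf hv
      have hcu : IsUnit c := (mem_nonvanishingLocus_iff hv hc).mp (hUf ▸ h2)
      rw [mem_nonvanishingLocus_iff (hv.nsmul n) (a := X.presheaf.germ U y h2 s * c ^ n)]
      · exact ((X.mem_basicOpen s y h2).mp h).mul (hcu.pow n)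
      · rw [map_mul, map_pow, hc, Scheme.algebraMap_germ_eq_germToFunctionField,
          Units.val_pow_eq_pow_val]
        ring
  refine ⟨m * (n + 1), _, ?_, fun y hy h => ?_, (key w).mpr hws⟩
  · rw [mul_nsmul, succ_nsmul]
    exact mul_mem_globalSections hn hf
  · exact hs ((key y).mp h) hy

end CartierDivisor

end Ample

/-! ### Sections of big divisors -/

section Big

open Algebra Algebra.IsAlgebraic IntermediateField.algebraAdjoinAdjoin in
lemma isAlgebraic_adjoin_of_trdeg_eq {k K : Type u} [Field k] [Field K] [Algebra k K]
    [Algebra.EssFiniteType k K] {S : Set K}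
    (h : Algebra.trdeg k (IntermediateField.adjoin k S) = Algebra.trdeg k K) :
    Algebra.IsAlgebraic (Algebra.adjoin k S) K := by
  have h0 : Algebra.trdeg (IntermediateField.adjoin k S) K = 0 := by
    have h1 := trdeg_add_eq k (IntermediateField.adjoin k S) (A := K)
    rw [h] at h1
    exact Cardinal.eq_of_add_eq_add_left (h1.trans (add_zero _).symm)
      (trdeg_lt_aleph0 k K)
  have : Algebra.IsAlgebraic (IntermediateField.adjoin k S) K := trdeg_eq_zero_iff.mp h0
  exact (IsFractionRing.comap_isAlgebraic_iff (A := Algebra.adjoin k S)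
    (K := IntermediateField.adjoin k S)).mpr this

variable {X : Scheme.{u}} [IsIntegral X]

/-- The local ring at a point other than the generic point is not a field. -/
lemma exists_nonzero_nonunit_stalk {x : X} (hx : x ≠ genericPoint X) :
    ∃ c : X.presheaf.stalk x, c ≠ 0 ∧ ¬ IsUnit c := by
  by_contra! h
  obtain ⟨z, hz⟩ : genericPoint X ∈ Set.range (X.fromSpecStalk x) := by
    rw [Scheme.range_fromSpecStalk]
    exact (genericPoint_spec X).specializes trivial
  have hz' : z = IsLocalRing.closedPoint (X.presheaf.stalk x) := by
    apply PrimeSpectrum.ext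
    refine le_antisymm (IsLocalRing.le_maximalIdeal z.2.ne_top) fun c hc => ?_
    have hc : ¬ IsUnit c := (IsLocalRing.mem_maximalIdeal c).mp hc
    rw [not_imp_comm.mp (h c) hc]
    exact z.asIdeal.zero_mem
  rw [hz', Scheme.fromSpecStalk_closedPoint] at hz
  exact hx hz

namespace CartierDivisor

lemma genericPoint_mem_nonvanishingLocus {D : CartierDivisor X} {f : X.functionField}
    (hf : f ∈ D.globalSections) (h0 : f ≠ 0) : genericPoint X ∈ D.nonvanishingLocus f := by
  obtain ⟨v, hv, a, ha⟩ := mem_globalSections_iff.mp hf (genericPoint X)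
  rw [mem_nonvanishingLocus_iff hv ha]
  have ha0 : a ≠ 0 := by
    rintro rfl
    rw [map_zero] at ha
    exact mul_ne_zero h0 v.ne_zero ha.symm
  exact Ne.isUnit (G₀ := X.functionField) ha0

variable {k : Type u} [Field k] {p : X ⟶ Spec (.of k)}

/-- If no denominator occurring in the linear system `|mD|` vanishes at `x`, then every polynomial
in the quotients of its sections has the form `s / g`, where `s` and `g` are sections of a multiple
of `mD` and `g` does not vanish at `x`. -/
lemma exists_denominator_of_mem_adjoin [Algebra k X.functionField]
    (hp : algebraMap k X.functionField = constants p) {E : CartierDivisor X} {x : X}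
    (hE : ∀ g ∈ E.globalSections, g ≠ 0 → x ∈ E.nonvanishingLocus g) {h : X.functionField}
    (hh : h ∈ Algebra.adjoin k {h : X.functionField | ∃ f ∈ E.globalSections,
      ∃ g ∈ E.globalSections, g ≠ 0 ∧ h = f / g}) :
    ∃ r : ℕ, ∃ g ∈ (r • E).globalSections, g ≠ 0 ∧ x ∈ (r • E).nonvanishingLocus g ∧
      h * g ∈ (r • E).globalSections := by
  have hone : (1 : X.functionField) ∈ ((0 : ℕ) • E).globalSections ∧
      x ∈ ((0 : ℕ) • E).nonvanishingLocus 1 := by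
    rw [zero_nsmul]
    exact ⟨mem_globalSections_iff.mpr fun y => ⟨1, isLocalEquation_zero y, 1, by simp⟩,
      1, isLocalEquation_zero x, 1, by simp⟩
  induction hh using Algebra.adjoin_induction with
  | mem h hh =>
    obtain ⟨f, hf, g, hg, hg0, rfl⟩ := hh
    refine ⟨1, g, ?_, hg0, ?_, ?_⟩ <;> rw [one_nsmul]
    · exact hg
    · exact hE g hg hg0
    · rwa [div_mul_cancel₀ _ hg0]
  | algebraMap c =>
    refine ⟨0, 1, hone.1, one_ne_zero, hone.2, ?_⟩
    have h := (sectionSpace p hp ((0 : ℕ) • E)).smul_mem c (mem_sectionSpace.mpr hone.1)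
    rwa [Algebra.smul_def, mem_sectionSpace] at h
  | add a b _ _ iha ihb =>
    obtain ⟨r, g, hg, hg0, hgx, hag⟩ := iha
    obtain ⟨r', g', hg', hg0', hgx', hbg⟩ := ihb
    refine ⟨r + r', g * g', ?_, mul_ne_zero hg0 hg0', ?_, ?_⟩ <;> rw [add_nsmul]
    · exact mul_mem_globalSections hg hg'
    · rw [nonvanishingLocus_mul hg hg']
      exact ⟨hgx, hgx'⟩
    · rw [← mem_sectionSpace (p := p) (hp := hp)]
      convert add_mem (mem_sectionSpace.mpr (mul_mem_globalSections hag hg'))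
        (mem_sectionSpace.mpr (mul_mem_globalSections hg hbg)) using 1
      ring
  | mul a b _ _ iha ihb =>
    obtain ⟨r, g, hg, hg0, hgx, hag⟩ := iha
    obtain ⟨r', g', hg', hg0', hgx', hbg⟩ := ihb
    refine ⟨r + r', g * g', ?_, mul_ne_zero hg0 hg0', ?_, ?_⟩ <;> rw [add_nsmul]
    · exact mul_mem_globalSections hg hg'
    · rw [nonvanishingLocus_mul hg hg']
      exact ⟨hgx, hgx'⟩
    · convert mul_mem_globalSections hag hbg using 1
      ring

/-- If `D` is big, every point other than the generic one is a zero of a nonzero section of a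
multiple of `D`. Either a section of `mD` will do, or the local ring at the point contains all
quotients of sections of `mD`; a nonzero non-unit of this ring is algebraic over the algebra
generated by these quotients, so that the constant coefficient of an algebraic equation is a
polynomial in the quotients and a non-unit. -/
lemma IsBig.exists_section [LocallyOfFiniteType p] {D : CartierDivisor X} (hD : D.IsBig p) {x : X}
    (hx : x ≠ genericPoint X) :
    ∃ r : ℕ, ∃ s ∈ (r • D).globalSections, s ≠ 0 ∧ x ∉ (r • D).nonvanishingLocus s := by
  let : Algebra k X.functionField := (constants p).toAlgebra
  have hp : algebraMap k X.functionField = constants p := rfl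
  have := essFiniteType_functionField p hp
  obtain ⟨m, -, -, htr⟩ := hD
  have halg := isAlgebraic_adjoin_of_trdeg_eq htr
  by_cases hE : ∀ g ∈ (m • D).globalSections, g ≠ 0 → x ∈ (m • D).nonvanishingLocus g
  swap
  · push Not at hE
    obtain ⟨g, hg, hg0, hgx⟩ := hE
    exact ⟨m, g, hg, hg0, hgx⟩
  obtain ⟨c, hc0, hcu⟩ := exists_nonzero_nonunit_stalk hx
  have hc0' : algebraMap (X.presheaf.stalk x) X.functionField c ≠ 0 := by
    rwa [Ne, map_eq_zero_iff _ (stalk_algebraMap_injective x)]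
  obtain ⟨q, hq0, hq⟩ := (halg.isAlgebraic
    (algebraMap (X.presheaf.stalk x) X.functionField c)).exists_nonzero_coeff_and_aeval_eq_zero
      (mem_nonZeroDivisors_of_ne_zero hc0')
  -- the elements of `k[f/g]` lie in the local ring at `x`
  have hle (h) (hh : h ∈ Algebra.adjoin k {h : X.functionField | ∃ f ∈ (m • D).globalSections,
      ∃ g ∈ (m • D).globalSections, g ≠ 0 ∧ h = f / g}) :
      ∃ a, algebraMap (X.presheaf.stalk x) X.functionField a = h := by
    obtain ⟨r, g, hg, -, hgx, hhg⟩ := exists_denominator_of_mem_adjoin hp hE hh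
    obtain ⟨v, hv, b, hb⟩ := hgx
    obtain ⟨a, ha⟩ := exists_stalk_of_mem_globalSections hhg hv
    refine ⟨a * ↑b⁻¹, ?_⟩
    have hbb := congrArg (algebraMap (X.presheaf.stalk x) X.functionField) b.mul_inv
    rw [map_mul, map_one] at hbb
    rw [map_mul, ha, mul_assoc h, hb, mul_assoc, hbb, mul_one]
  obtain ⟨e, he⟩ := hle _ (q.coeff 0).2
  -- the algebraic equation shows that `c` divides the constant coefficient in the local ring
  have heu : ¬ IsUnit e := by
    choose γ hγ using fun i => hle _ (q.divX.coeff i).2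
    have hsum : algebraMap (X.presheaf.stalk x) X.functionField
        ((∑ i ∈ Finset.range (q.divX.natDegree + 1), γ i * c ^ i) * c + e) = 0 := by
      rw [map_add, map_mul, map_sum]
      simp only [map_mul, map_pow, hγ, he]
      rw [← q.divX_mul_X_add, map_add, map_mul, Polynomial.aeval_X, Polynomial.aeval_C,
        Polynomial.aeval_eq_sum_range] at hq
      refine Eq.trans ?_ hq
      simp [Algebra.smul_def]
    have hsum' := (map_eq_zero_iff _ (stalk_algebraMap_injective x)).mp hsum
    rw [eq_neg_of_add_eq_zero_right hsum', IsUnit.neg_iff]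
    exact fun h => hcu (isUnit_of_mul_isUnit_right h)
  obtain ⟨r, g, hg, hg0, -, hhg⟩ := exists_denominator_of_mem_adjoin hp hE (q.coeff 0).2
  obtain ⟨v, hv, b, hb⟩ := mem_globalSections_iff.mp hg x
  refine ⟨m * r, (q.coeff 0 : X.functionField) * g, ?_, mul_ne_zero (by simpa using hq0) hg0, ?_⟩
  · rwa [mul_nsmul]
  · rw [mul_nsmul, mem_nonvanishingLocus_iff hv (a := e * b)
      (by rw [map_mul, he, hb, mul_assoc])]
    exact fun h => heu (isUnit_of_mul_isUnit_left h)

/-- If `D` is big, every proper closed subset lies in the zero locus of a nonzero section of a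
multiple of `D`. -/
lemma IsBig.exists_section_of_isClosed [LocallyOfFiniteType p]
    [TopologicalSpace.NoetherianSpace X] {D : CartierDivisor X} (hD : D.IsBig p) {Y : Set X}
    (hY : IsClosed Y) (hne : Y ≠ Set.univ) :
    ∃ r : ℕ, ∃ s ∈ (r • D).globalSections, s ≠ 0 ∧ Y ⊆ ((r • D).nonvanishingLocus s)ᶜ := by
  obtain ⟨S, hS, hScl, hSirr, rfl⟩ :=
    TopologicalSpace.NoetherianSpace.exists_finite_set_isClosed_irreducible hY
  have hSne : ∀ t ∈ S, t ≠ Set.univ := by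
    rintro t ht rfl
    exact hne (Set.eq_univ_of_univ_subset (Set.subset_sUnion_of_mem ht))
  clear hY hne
  induction S, hS using Set.Finite.induction_on with
  | empty =>
    refine ⟨0, 1, ?_, one_ne_zero, by simp⟩
    rw [zero_nsmul]
    exact mem_globalSections_iff.mpr fun y => ⟨1, isLocalEquation_zero y, 1, by simp⟩
  | @insert t S _ _ ih =>
    obtain ⟨r, s, hs, hs0, hsS⟩ := ih (fun t ht => hScl t (.inr ht)) (fun t ht => hSirr t (.inr ht))
      (fun t ht => hSne t (.inr ht))
    have ht := (hSirr t (.inl rfl)).isGenericPoint_genericPoint_closure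
    rw [(hScl t (.inl rfl)).closure_eq] at ht
    obtain ⟨r', s', hs', hs0', hxs⟩ := hD.exists_section (x := (hSirr t (.inl rfl)).genericPoint)
      (fun h => hSne t (.inl rfl) (by rw [← ht.def, h, (genericPoint_spec X).def]))
    refine ⟨r' + r, s' * s, ?_, mul_ne_zero hs0' hs0, ?_⟩ <;> rw [add_nsmul]
    · exact mul_mem_globalSections hs' hs
    · rw [nonvanishingLocus_mul hs' hs, Set.sUnion_insert, Set.compl_inter]
      refine Set.union_subset_union ?_ hsS
      rw [← ht.def]
      exact closure_minimal (Set.singleton_subset_iff.mpr hxs)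
        (isOpen_nonvanishingLocus _ _).isClosed_compl

end CartierDivisor

end Big

/-! ### Automorphisms preserving a divisor class -/

section Divisors

variable {X : Scheme.{u}} {k : Type u} [Field k] {p : X ⟶ Spec (.of k)}

lemma noetherianSpace_of_locallyOfFiniteType (p : X ⟶ Spec (.of k)) [LocallyOfFiniteType p]
    [QuasiCompact p] : TopologicalSpace.NoetherianSpace X := by
  have := LocallyOfFiniteType.isLocallyNoetherian p
  have : CompactSpace X := QuasiCompact.compactSpace_of_compactSpace p
  have : IsNoetherian X := {}
  infer_instance

lemma pow_hom_comp {σ : Aut X} (hσ : σ.hom ≫ p = p) (n : ℕ) : (σ ^ n).hom ≫ p = p := by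
  induction n with
  | zero => exact Category.id_comp p
  | succ n ih =>
    rw [pow_succ']
    change ((σ ^ n).hom ≫ σ.hom) ≫ p = p
    rw [Category.assoc, hσ, ih]

variable [IsIntegral X]

/-- Good dense orbits on `Z`, provided that the sections of the multiples of a divisor `D` with
`(σⁿ)^* D ∼ D` detect the proper closed subsets of the irreducible components of `Z`. -/
theorem hasGoodDenseOrbitsOn_of_linEquiv [IsAlgClosed k] [IsProper p] {σ : Aut X}
    (hσ : σ.hom ≫ p = p) {D : CartierDivisor X} {n : ℕ} (hn : 1 ≤ n)
    (hD : CartierDivisor.LinEquiv (D.pullback (σ ^ n).hom) D) {Z : Set X} (hZ : IsClosed Z)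
    (hZσ : IsInvariant σ Z)
    (hsep : ∀ W, IsClosed W → IsComponentOf Z W → ∀ Y ⊂ W, IsClosed Y →
      ∃ r : ℕ, ∃ s ∈ (r • D).globalSections, Y ⊆ ((r • D).nonvanishingLocus s)ᶜ ∧
        ¬ W ⊆ ((r • D).nonvanishingLocus s)ᶜ) :
    HasGoodDenseOrbitsOn σ Z := by
  let : Algebra k X.functionField := (constants p).toAlgebra
  have hp : algebraMap k X.functionField = constants p := rfl
  have := essFiniteType_functionField p hp
  have := noetherianSpace_of_locallyOfFiniteType p
  obtain ⟨f, hf⟩ := hD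
  let S := linearizedSections hp (pow_hom_comp hσ n) D f hf
  apply hasGoodDenseOrbitsOn_of_exists
  refine exists_isOpen_dense_iff_of_components (autHomeo σ) hn hZ hZσ
    fun W N hW hWcl hWinv _ hWZ => ?_
  have hτ : autHomeo σ ^ (n * N) = autHomeo (σ ^ n) ^ N := by rw [map_pow, pow_mul]
  rw [hτ] at hWinv ⊢
  refine (S.iterate N).exists_isOpen_dense_iff hW hWcl hWinv fun Y hYW hY => ?_
  obtain ⟨r, s, hs, hYs, hWs⟩ := hsep W hWcl hWZ Y hYW hY
  refine ⟨r, s, ?_, ?_⟩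
  · rw [LinearizedSections.mem_vanishing]
    exact ⟨hs, hYs⟩
  · rw [LinearizedSections.mem_vanishing]
    exact fun h => hWs h.2

theorem isOrdinary_of_isAmple [IsAlgClosed k] [IsProper p] {σ : Aut X}
    (hσ : σ.hom ≫ p = p) {D : CartierDivisor X} {n : ℕ} (hn : 1 ≤ n) (hample : D.IsAmple)
    (hD : CartierDivisor.LinEquiv (D.pullback (σ ^ n).hom) D) : IsOrdinary σ := by
  refine fun Z hZ => hasGoodDenseOrbitsOn_of_linEquiv hσ hn hD hZ.1 hZ.2.1
    fun W _ _ Y hYW hY => ?_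
  obtain ⟨w, hw, hwY⟩ := Set.exists_of_ssubset hYW
  obtain ⟨r, s, hs, hYs, hws⟩ := hample.exists_section hY hwY
  exact ⟨r, s, hs, hYs, fun h => h hw hws⟩

theorem hasGoodDenseOrbits_of_isBig [IsAlgClosed k] [IsProper p] {σ : Aut X}
    (hσ : σ.hom ≫ p = p) {D : CartierDivisor X} {n : ℕ} (hn : 1 ≤ n) (hbig : D.IsBig p)
    (hD : CartierDivisor.LinEquiv (D.pullback (σ ^ n).hom) D) : HasGoodDenseOrbits σ := by
  have := noetherianSpace_of_locallyOfFiniteType p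
  refine hasGoodDenseOrbitsOn_of_linEquiv hσ hn hD isClosed_univ
    (Set.image_univ_of_surjective (autHomeo σ).surjective) fun W _ hWZ Y hYW hY => ?_
  have hW : W = Set.univ := Set.eq_univ_of_univ_subset
    (hWZ.2 ⟨IrreducibleSpace.isIrreducible_univ X, isClosed_univ, subset_rfl⟩ (Set.subset_univ W))
  subst hW
  obtain ⟨r, s, hs, hs0, hYs⟩ := hbig.exists_section_of_isClosed hY hYW.ne
  exact ⟨r, s, hs, hYs, fun h =>
    h (Set.mem_univ _) (CartierDivisor.genericPoint_mem_nonvanishingLocus hs hs0)⟩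

end Divisors

/-! ### Actions of group objects on points -/

section GroupActions

open MonoidalCategory CartesianMonoidalCategory MonoidalLeftAction
open scoped MonObj

section Points

universe v w

variable {C : Type w} [Category.{v} C] [CartesianMonoidalCategory C] {G X T : C} [GrpObj G]
  [ModObj G X]

/-- The action of the `T`-valued points of `G` on the `T`-valued points of `X`. -/
def pointAct (g : T ⟶ G) (x : T ⟶ X) : T ⟶ X := lift g x ≫ ModObj.smul (M := G) (X := X)

lemma one_pointAct (x : T ⟶ X) : pointAct (1 : T ⟶ G) x = x := by
  have h := ModObj.one_smul (M := G) X
  have h1 : lift (1 : T ⟶ G) x = lift (toUnit T) x ≫ (η : 𝟙_ C ⟶ G) ▷ X := by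
    rw [lift_whiskerRight, Hom.one_def]
  rw [pointAct, h1, Category.assoc]
  refine (congrArg (lift (toUnit T) x ≫ ·) h).trans ?_
  exact lift_leftUnitor_hom _ _

lemma mul_pointAct (g h : T ⟶ G) (x : T ⟶ X) :
    pointAct (g * h) x = pointAct g (pointAct h x) := by
  have hm := ModObj.mul_smul (M := G) X
  have h1 : lift (g * h) x = lift (lift g h) x ≫ (μ : G ⊗ G ⟶ G) ▷ X := by
    rw [lift_whiskerRight, Hom.mul_def]
  rw [pointAct, h1, Category.assoc]
  refine (congrArg (lift (lift g h) x ≫ ·) hm).trans ?_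
  change lift (lift g h) x ≫ (α_ G G X).hom ≫ G ◁ ModObj.smul (M := G) (X := X) ≫
    ModObj.smul (M := G) (X := X) = _
  rw [← Category.assoc, lift_lift_associator_hom, ← Category.assoc, lift_whiskerLeft]
  rfl

variable (G) in
/-- The orbit map `G ⟶ X` of a point of `X`. -/
def orbitMap (x : 𝟙_ C ⟶ X) : G ⟶ X := pointAct (𝟙 G) (toUnit G ≫ x)

lemma comp_orbitMap (g : 𝟙_ C ⟶ G) (x : 𝟙_ C ⟶ X) : g ≫ orbitMap G x = pointAct g x := by
  rw [orbitMap, pointAct, ← Category.assoc, comp_lift, Category.comp_id, ← Category.assoc,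
    toUnit_unique (g ≫ toUnit G) (𝟙 _), Category.id_comp, pointAct]

lemma comp_leftUnitor_inv_whiskerRight_smul (g : 𝟙_ C ⟶ G) (x : 𝟙_ C ⟶ X) :
    x ≫ (λₗ X).inv ≫ g ⊵ₗ X ≫ ModObj.smul = pointAct g x := by
  change x ≫ (λ_ X).inv ≫ g ▷ X ≫ ModObj.smul (M := G) (X := X) = _
  have h : x ≫ (λ_ X).inv ≫ g ▷ X = lift g x := by
    ext
    · simp only [Category.assoc, whiskerRight_fst, lift_fst]
      rw [← Category.assoc, ← Category.assoc, toUnit_unique ((x ≫ _) ≫ _) (𝟙 _), Category.id_comp]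
    · simp
  simp only [← Category.assoc] at h ⊢
  rw [h, pointAct]

end Points

variable {k : Type u} [Field k] {G X : Over (Spec (.of k))} [GrpObj G] [ModObj G X]

lemma comp_actBy (g : 𝟙_ (Over (Spec (.of k))) ⟶ G) (x : 𝟙_ (Over (Spec (.of k))) ⟶ X) :
    x ≫ actBy g = pointAct g x :=
  comp_leftUnitor_inv_whiskerRight_smul g x

end GroupActions

/-! ### Constructible dense subsets -/

section Constructible

variable {X : Type*} [TopologicalSpace X]

/-- Every nonempty set has a nonempty relatively open subset which is contained in a given
constructible set or disjoint from it. -/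
lemma exists_isOpen_inter_subset_or {C : Set X} (hC : Topology.IsConstructible C) {Z : Set X}
    (hZ : Z.Nonempty) :
    ∃ U, IsOpen U ∧ (U ∩ Z).Nonempty ∧ (U ∩ Z ⊆ C ∨ U ∩ Z ⊆ Cᶜ) := by
  induction hC using Topology.IsConstructible.empty_union_induction generalizing Z with
  | open_retrocompact U hU _ =>
    rcases (U ∩ Z).eq_empty_or_nonempty with h | h
    · refine ⟨Set.univ, isOpen_univ, by rwa [Set.univ_inter], .inr ?_⟩
      rw [Set.univ_inter, Set.subset_compl_iff_disjoint_left, Set.disjoint_iff_inter_eq_empty, h]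
    · exact ⟨U, hU, h, .inl Set.inter_subset_left⟩
  | union C₁ _ C₂ _ h₁ h₂ =>
    obtain ⟨U₁, hU₁, hne₁, h | h⟩ := h₁ hZ
    · exact ⟨U₁, hU₁, hne₁, .inl (h.trans Set.subset_union_left)⟩
    obtain ⟨U₂, hU₂, hne₂, h'⟩ := h₂ hne₁
    rw [← Set.inter_assoc] at hne₂ h'
    refine ⟨U₂ ∩ U₁, hU₂.inter hU₁, hne₂, h'.imp (·.trans Set.subset_union_right) fun h' => ?_⟩
    rw [Set.compl_union]
    exact Set.subset_inter ((Set.inter_subset_inter_left _ Set.inter_subset_right).trans h) h'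
  | compl C _ h =>
    obtain ⟨U, hU, hne, h⟩ := h hZ
    exact ⟨U, hU, hne, h.symm.imp_right (by rw [compl_compl]; exact id)⟩

/-- A constructible dense subset of a nonempty set contains a nonempty relatively open subset. -/
lemma exists_isOpen_inter_subset {C : Set X} (hC : Topology.IsConstructible C) {Z : Set X}
    (hZ : Z.Nonempty) (hd : Z ⊆ closure (C ∩ Z)) :
    ∃ U, IsOpen U ∧ (U ∩ Z).Nonempty ∧ U ∩ Z ⊆ C := by
  obtain ⟨U, hU, ⟨x, hxU, hxZ⟩, h | h⟩ := exists_isOpen_inter_subset_or hC hZ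
  · exact ⟨U, hU, ⟨x, hxU, hxZ⟩, h⟩
  · obtain ⟨y, hyU, hyC, hyZ⟩ := mem_closure_iff.mp (hd hxZ) U hU hxU
    exact absurd hyC (h ⟨hyU, hyZ⟩)

end Constructible

/-! ### Orbits under algebraic groups -/

section RationalPoints

open MonoidalCategory CartesianMonoidalCategory MonoidalLeftAction
open scoped MonObj

variable {k : Type u} [Field k] {G X Y : Over (Spec (.of k))}

/-- The underlying point of a `k`-rational point. -/
noncomputable def underlyingPoint (t : 𝟙_ (Over (Spec (.of k))) ⟶ X) : X.left :=
  t.left (IsLocalRing.closedPoint k : Spec (.of k))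

lemma underlyingPoint_comp (t : 𝟙_ (Over (Spec (.of k))) ⟶ X) (f : X ⟶ Y) :
    underlyingPoint (t ≫ f) = f.left (underlyingPoint t) := rfl

lemma exists_underlyingPoint_eq [IsAlgClosed k] [LocallyOfFiniteType X.hom] {x : X.left}
    (hx : IsClosed {x}) : ∃ t : 𝟙_ (Over (Spec (.of k))) ⟶ X, underlyingPoint t = x :=
  ⟨Over.homMk (U := 𝟙_ (Over (Spec (.of k)))) (pointOfClosedPoint X.hom x hx)
    (pointOfClosedPoint_comp X.hom x hx), pointOfClosedPoint_apply X.hom x hx _⟩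

variable [GrpObj G] [ModObj G X]

/-- If `g ∈ G(k)` acts by `σ`, then `gⁱ` acts on rational points by `σⁱ`. -/
lemma underlyingPoint_zpow_pointAct {σ : Aut X.left} {g : 𝟙_ (Over (Spec (.of k))) ⟶ G}
    (hg : (actBy (X := X) g).left = σ.hom) (i : ℤ) (x : 𝟙_ (Over (Spec (.of k))) ⟶ X) :
    underlyingPoint (pointAct (g ^ i) x) = (autHomeo σ ^ i) (underlyingPoint x) := by
  have h1 (x : 𝟙_ (Over (Spec (.of k))) ⟶ X) :
      underlyingPoint (pointAct g x) = autHomeo σ (underlyingPoint x) := by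
    rw [← comp_actBy, underlyingPoint_comp, hg]
    rfl
  induction i generalizing x with
  | zero => rw [zpow_zero, zpow_zero, one_pointAct]; rfl
  | succ i ih => rw [zpow_add_one, zpow_add_one, mul_pointAct, ih, h1]; rfl
  | pred i ih =>
    rw [zpow_sub_one, zpow_sub_one, mul_pointAct, ih, homeo_mul_apply]
    congr 1
    apply (autHomeo σ).injective
    rw [← h1, ← mul_pointAct, mul_inv_cancel, one_pointAct]
    exact ((autHomeo σ).apply_symm_apply _).symm

/-- A group action has good dense orbits on every closed subset invariant under a rational point
`g`. If `z` has a dense orbit, the image of the closure `H` of `{gⁱ}` under the orbit map of `z`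
contains a nonempty open subset of `Z`. A closed point of this open subset is of the form `h z` with
`h ∈ H(k)`, and the closure of its orbit contains `H h z`, hence `z`, because `h⁻¹ ∈ H`. -/
theorem isOrdinary_of_action [IsAlgClosed k] [LocallyOfFiniteType G.hom] [QuasiCompact G.hom]
    [LocallyOfFiniteType X.hom] [QuasiCompact X.hom] {σ : Aut X.left}
    {g : 𝟙_ (Over (Spec (.of k))) ⟶ G} (hg : (actBy (X := X) g).left = σ.hom) :
    IsOrdinary σ := by
  rintro Z ⟨hZ, hZσ : autHomeo σ '' Z = Z, -⟩
  have := noetherianSpace_of_locallyOfFiniteType G.hom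
  have := noetherianSpace_of_locallyOfFiniteType X.hom
  have := LocallyOfFiniteType.isLocallyNoetherian X.hom
  apply hasGoodDenseOrbitsOn_of_exists
  by_cases hex : ∃ z ∈ Z, IsClosed {z} ∧ closure (homeoOrbit (autHomeo σ) z) = Z
  swap
  · push Not at hex
    exact ⟨∅, isOpen_empty, fun z hz hzc => by simpa using hex z hz hzc⟩
  obtain ⟨z, hzZ, hzc, hzd⟩ := hex
  obtain ⟨z, rfl⟩ := exists_underlyingPoint_eq hzc
  have horbit (x : 𝟙_ (Over (Spec (.of k))) ⟶ X) (i : ℤ) :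
      (orbitMap G x).left (underlyingPoint (g ^ i)) = (autHomeo σ ^ i) (underlyingPoint x) := by
    rw [← underlyingPoint_comp, comp_orbitMap, underlyingPoint_zpow_pointAct hg]
  let H : Set G.left := closure (Set.range fun i : ℤ => underlyingPoint (g ^ i))
  -- the closure of an orbit is the closure of the image of `H`
  have hH (x : 𝟙_ (Over (Spec (.of k))) ⟶ X) :
      (orbitMap G x).left '' H ⊆ closure (homeoOrbit (autHomeo σ) (underlyingPoint x)) := by
    refine (image_closure_subset_closure_image (orbitMap G x).left.continuous).trans
      (closure_mono ?_)
    rintro _ ⟨_, ⟨i, rfl⟩, rfl⟩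
    exact ⟨i, (horbit x i).symm⟩
  have hconstr : Topology.IsConstructible ((orbitMap G z).left '' H) := by
    have hcomp : (orbitMap G z).left ≫ X.hom = G.hom := Over.w _
    have : LocallyOfFiniteType ((orbitMap G z).left ≫ X.hom) := by rw [hcomp]; infer_instance
    have := locallyOfFiniteType_of_comp (orbitMap G z).left X.hom
    refine Scheme.Hom.isConstructible_image _ ?_
    rw [← compl_compl H]
    exact (IsRetrocompact.isConstructible isClosed_closure.isOpen_compl
      fun U _ _ => TopologicalSpace.NoetherianSpace.isCompact _).compl
  obtain ⟨U, hU, hUne, hUH⟩ := exists_isOpen_inter_subset hconstr ⟨_, hzZ⟩ (by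
    conv_lhs => rw [← hzd]
    refine closure_mono ?_
    rintro _ ⟨i, rfl⟩
    refine ⟨⟨_, subset_closure ⟨i, rfl⟩, horbit z i⟩, homeoOrbit_subset hZσ hzZ ⟨i, rfl⟩⟩)
  refine ⟨⋃ i : ℤ, (autHomeo σ ^ i) ⁻¹' U,
    isOpen_iUnion fun i => hU.preimage (autHomeo σ ^ i).continuous, fun w hwZ hwc => ?_⟩
  rw [Set.mem_iUnion]
  constructor
  · intro hwd
    obtain ⟨x, hxU, hxZ⟩ := hUne
    rw [← hwd] at hxZ
    obtain ⟨_, hyU, i, rfl⟩ := mem_closure_iff.mp hxZ U hU hxU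
    exact ⟨i, hyU⟩
  · rintro ⟨i, hi : (autHomeo σ ^ i) w ∈ U⟩
    rw [← homeoOrbit_zpow_apply (autHomeo σ) i]
    have hw'Z : (autHomeo σ ^ i) w ∈ Z := homeoOrbit_subset hZσ hwZ ⟨i, rfl⟩
    have hw'c : IsClosed {(autHomeo σ ^ i) w} := by
      rw [← Set.image_singleton]
      exact (autHomeo σ ^ i).isClosedMap _ hwc
    generalize (autHomeo σ ^ i) w = w' at hi hw'Z hw'c
    obtain ⟨h, hhH, hhw⟩ := hUH ⟨hi, hw'Z⟩
    obtain ⟨h, ⟨hhH, hhw⟩, hhc⟩ := IsClosed.exists_closed_singleton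
      (isClosed_closure.inter (hw'c.preimage (orbitMap G z).left.continuous)) ⟨h, hhH, hhw⟩
    obtain ⟨h, rfl⟩ := exists_underlyingPoint_eq hhc
    have hw' : w' = underlyingPoint (pointAct h z) := by
      rw [← comp_orbitMap, underlyingPoint_comp]
      exact hhw.symm
    subst hw'
    refine subset_antisymm (closure_minimal (homeoOrbit_subset hZσ hw'Z) hZ) ?_
    -- inversion maps the powers of `g` to the powers of `g`
    have hinv : underlyingPoint h⁻¹ ∈ H := by
      have h1 : (ι[G]).left '' H ⊆ H := by
        refine (image_closure_subset_closure_image (ι[G]).left.continuous).trans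
          (closure_mono ?_)
        rintro _ ⟨_, ⟨i, rfl⟩, rfl⟩
        refine ⟨-i, ?_⟩
        change underlyingPoint _ = _
        rw [zpow_neg, Hom.inv_def, underlyingPoint_comp]
      rw [Hom.inv_def, underlyingPoint_comp]
      exact h1 ⟨_, hhH, rfl⟩
    have hz : underlyingPoint z ∈
        closure (homeoOrbit (autHomeo σ) (underlyingPoint (pointAct h z))) := by
      refine hH _ ⟨_, hinv, ?_⟩
      rw [← underlyingPoint_comp, comp_orbitMap, ← mul_pointAct, inv_mul_cancel, one_pointAct]
    conv_lhs => rw [← hzd]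
    exact closure_minimal (homeoOrbit_subset (image_closure_homeoOrbit _ _) hz) isClosed_closure

end RationalPoints

end SchemeDynamics

theorem mainTheorem10 {k : Type u} [Field k] [IsAlgClosed k] [Uncountable k]
    {X : Scheme.{u}} [IsIntegral X] (p : X ⟶ Spec (.of k)) [LocallyOfFiniteType p]
    [QuasiCompact p] (σ : Aut X) (hσ : σ.hom ≫ p = p) :
    (∀ (G : Over (Spec (.of k))) [GrpObj G] [ModObj G (Over.mk p)]
        (g : MonoidalCategoryStruct.tensorUnit (Over (Spec (.of k))) ⟶ G),
      SchemeDynamics.IsAlgebraicGroup G →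
      (SchemeDynamics.actBy (X := Over.mk p) g).left = σ.hom →
      SchemeDynamics.IsOrdinary σ) ∧
    (IsProper p → ∀ (D : SchemeDynamics.CartierDivisor X) (n : ℕ), 1 ≤ n → D.IsAmple →
      SchemeDynamics.CartierDivisor.LinEquiv (D.pullback (σ ^ n).hom) D →
      SchemeDynamics.IsOrdinary σ) ∧
    (IsProper p → ∀ (D : SchemeDynamics.CartierDivisor X) (n : ℕ), 1 ≤ n → D.IsBig p →
      SchemeDynamics.CartierDivisor.LinEquiv (D.pullback (σ ^ n).hom) D →
      SchemeDynamics.HasGoodDenseOrbits σ) := by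
  refine ⟨fun G _ _ g hG hg => ?_, fun _ D n hn hD hlin => ?_, fun _ D n hn hD hlin => ?_⟩
  · obtain ⟨-, _, _⟩ := hG
    have : LocallyOfFiniteType (Over.mk p).hom := ‹LocallyOfFiniteType p›
    have : QuasiCompact (Over.mk p).hom := ‹QuasiCompact p›
    exact SchemeDynamics.isOrdinary_of_action (X := Over.mk p) hg
  · exact SchemeDynamics.isOrdinary_of_isAmple hσ hn hD hlin
  · exact SchemeDynamics.hasGoodDenseOrbits_of_isBig hσ hn hD hlin
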